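/- Let $G=(V,E)$ be a cubic (simple, 3-regular) graph on $n$ vertices, let $v_1,\dots,v_n$ and $e_1,\dots,e_m$ ($m=3n/2$) be arbitrary orderings of its vertices and of its edges, and set $q=200n^3+1$, $p=2q+7n$, $q'=10n^2+1$, $p'=2q'+7n$. Let $G'$ be the intersection graph of the following intervals of the real line. (Gadgets.) For each vertex there is a V-gadget, consisting of $q$ left long, $p$ left short, $q$ right long and $p$ right short intervals; for each edge there is an E-gadget, consisting of $q'$ left long, $p'$ left short, $q'$ right long and $p'$ right short intervals. In each gadget the long intervals pairwise intersect, the short intervals are pairwise disjoint, each left (right) short interval intersects all left (right) long intervals and no right (left) long interval. Along the line the left short intervals of a gadget lie to the left of its right short intervals, and the gadgets are placed from left to right in the order $\mathcal G(v_1),\dots,\mathcal G(v_n),\mathcal G(e_1),\dots,\mathcal G(e_m)$; intervals of different gadgets are disjoint. (Link intervals.) For each edge $e=\{v_i,v_j\}$ with $i<j$ there are four link intervals. Two of them extend from $\mathcal G(v_i)$, of which they intersect exactly the right long intervals, to $\mathcal G(e)$, of which they intersect exactly the left long intervals. The other two extend from $\mathcal G(v_j)$, of which they intersect exactly the right long intervals,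 to $\mathcal G(e)$, of which they intersect exactly the left long and the left short intervals. (So a link interval intersects all intervals of every gadget strictly between its two end gadgets and no interval of the gadgets outside that range, and any two link intervals intersect.) A cut of a graph is a partition of its vertex set into two disjoint (possibly empty) sets, and its size is the number of edges with one endpoint in each of them. Then, for every integer $x\ge 0$, $G$ has a cut of size at least $x$ if and only if $G'$ has a cut of size at least $$(2pq+q^2)n+\tfrac32(2p'q'+q'^2)n+3n(n-1)(p+q)+3n\left(\tfrac32n-1\right)(p'+q')+6nq+3np'+2xq'.$$ -/

import Mathlib

/-- `G` has a cut of size at least `k`: the vertex set is partitioned into two disjoint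
sets `A` and `B`, and at least `k` edges have one endpoint in `A` and the other in `B`. -/
def SimpleGraph.HasCutOfSizeAtLeast {V : Type*} [Finite V] (G : SimpleGraph V) (k : ℚ) : Prop :=
  ∃ A B : Set V, A ∪ B = Set.univ ∧ A ∩ B = ∅ ∧
    k ≤ (Set.ncard {e ∈ G.edgeSet | ∃ u ∈ A, ∃ v ∈ B, e = s(u, v)} : ℚ)

namespace MaxCutReduction

/-- The number of left (equivalently right) long intervals of a V-gadget. -/
def vLong (n : ℕ) : ℕ := 200 * n ^ 3 + 1

/-- The number of left (equivalently right) short intervals of a V-gadget. -/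
def vShort (n : ℕ) : ℕ := 2 * vLong n + 7 * n

/-- The number of left (equivalently right) long intervals of an E-gadget. -/
def eLong (n : ℕ) : ℕ := 10 * n ^ 2 + 1

/-- The number of left (equivalently right) short intervals of an E-gadget. -/
def eShort (n : ℕ) : ℕ := 2 * eLong n + 7 * n

/-- The (names of the) intervals of a gadget with `q` long and `p` short intervals on each side. -/
abbrev Gadget (q p : ℕ) : Type := (Fin q ⊕ Fin p) ⊕ (Fin q ⊕ Fin p)

namespace Gadget

variable {q p : ℕ}

/-- A left long interval. -/
abbrev leftLong (a : Fin q) : Gadget q p := Sum.inl (Sum.inl a)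

/-- A left short interval. -/
abbrev leftShort (a : Fin p) : Gadget q p := Sum.inl (Sum.inr a)

/-- A right long interval. -/
abbrev rightLong (a : Fin q) : Gadget q p := Sum.inr (Sum.inl a)

/-- A right short interval. -/
abbrev rightShort (a : Fin p) : Gadget q p := Sum.inr (Sum.inr a)

/-- The left and right endpoint of each interval of a gadget that is placed at offset `o`.
From left to right: the left endpoints of the left long intervals, the left short intervals, the
point `o + q + 2 * p + 2` at which all left long intervals end and all right long intervals
begin, the right short intervals, the right endpoints of the right long intervals. -/
def ends (o : ℕ) : Gadget q p → ℕ × ℕ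
  | Sum.inl (Sum.inl a) => (o + 1 + a, o + q + 2 * p + 2)
  | Sum.inl (Sum.inr a) => (o + q + 1 + 2 * a, o + q + 2 + 2 * a)
  | Sum.inr (Sum.inl a) => (o + q + 2 * p + 2, o + q + 4 * p + 5 + a)
  | Sum.inr (Sum.inr a) => (o + q + 2 * p + 3 + 2 * a, o + q + 2 * p + 4 + 2 * a)

end Gadget

/-- A gadget placed at offset `o` lies strictly between `o` and `o + gadgetWidth q p`. -/
def gadgetWidth (q p : ℕ) : ℕ := 2 * q + 4 * p + 5

/-- Offset of the V-gadget of the `i`-th vertex; the V-gadgets are placed from left to right. -/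
def vOffset (n : ℕ) (i : Fin n) : ℕ := i * gadgetWidth (vLong n) (vShort n)

/-- Offset of the E-gadget of the `j`-th edge; the E-gadgets follow all the V-gadgets. -/
def eOffset (n : ℕ) {m : ℕ} (j : Fin m) : ℕ :=
  n * gadgetWidth (vLong n) (vShort n) + j * gadgetWidth (eLong n) (eShort n)

/-- The ways in which a link interval can meet the E-gadget at which it ends: `second` (it meets
only the left long intervals) or `third` (only the left long and the left short intervals). -/
inductive Manner : Type
  | second : Manner
  | third : Manner
  deriving DecidableEq

instance : Fintype Manner where
  elems := {Manner.second, Manner.third}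
  complete t := by cases t <;> simp

/-- The intervals of the construction for `n` vertices and `m` edges, that is, the vertices of
the reduction graph: those of the `n` V-gadgets, those of the `m` E-gadgets, and, for every edge
and every manner, a pair of link intervals. -/
abbrev Vertex (n m : ℕ) : Type :=
  (Fin n × Gadget (vLong n) (vShort n)) ⊕ (Fin m × Gadget (eLong n) (eShort n)) ⊕
    (Fin m × Manner × Fin 2)

/-- Left endpoint of the `c`-th interval of a pair of link intervals that starts at the `i`-th
V-gadget: to the right of all the right short intervals of that gadget, and inside all its right
long intervals. -/
def linkLeft (n : ℕ) (i : Fin n) (c : Fin 2) : ℕ :=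
  vOffset n i + vLong n + 4 * vShort n + 3 + c

/-- Right endpoint of a link interval that ends at the `j`-th E-gadget. -/
def linkRight (n : ℕ) {m : ℕ} (j : Fin m) : Manner → ℕ
  | Manner.second => eOffset n j + eLong n
  | Manner.third => eOffset n j + eLong n + 2 * eShort n + 1

section

variable {V : Type*} {G : SimpleGraph V} {n m : ℕ}

/-- The index of the endpoint of the `j`-th edge, in the vertex ordering `v`, from whose V-gadget
the link intervals of the given manner start. For an edge `{v i, v k}` with `i < k`, this is `i`
for the second manner and `k` for the third manner. -/
def linkSource (v : Fin n ≃ V) (e : Fin m ≃ G.edgeSet) (j : Fin m) : Manner → Fin n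
  | Manner.second => ((e j : Sym2 V).map v.symm).inf
  | Manner.third => ((e j : Sym2 V).map v.symm).sup

/-- The endpoints of the intervals, for the ordering `v` of the vertices and the ordering `e` of
the edges of `G`. -/
def ends (v : Fin n ≃ V) (e : Fin m ≃ G.edgeSet) : Vertex n m → ℕ × ℕ
  | Sum.inl (i, g) => Gadget.ends (vOffset n i) g
  | Sum.inr (Sum.inl (j, g)) => Gadget.ends (eOffset n j) g
  | Sum.inr (Sum.inr (j, t, c)) => (linkLeft n (linkSource v e j t) c, linkRight n j t)

/-- The closed intervals of the real line that make up the construction. -/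
def interval (v : Fin n ≃ V) (e : Fin m ≃ G.edgeSet) (a : Vertex n m) : Set ℝ :=
  Set.Icc ((ends v e a).1 : ℝ) ((ends v e a).2 : ℝ)

/-- The reduction graph: the intersection graph of the intervals of the construction. -/
def reductionGraph (v : Fin n ≃ V) (e : Fin m ≃ G.edgeSet) : SimpleGraph (Vertex n m) where
  Adj a b := a ≠ b ∧ (interval v e a ∩ interval v e b).Nonempty
  symm := ⟨fun _ _ h => ⟨h.1.symm, by rw [Set.inter_comm]; exact h.2⟩⟩
  loopless := ⟨fun _ h => h.1 rfl⟩

end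

/-- The cut size in the reduction graph that corresponds to the cut size `x` in a cubic graph on
`n` vertices. -/
def threshold (n x : ℕ) : ℚ :=
  let q : ℚ := vLong n
  let p : ℚ := vShort n
  let q' : ℚ := eLong n
  let p' : ℚ := eShort n
  (2 * p * q + q ^ 2) * n + 3 / 2 * (2 * p' * q' + q' ^ 2) * n + 3 * n * (n - 1) * (p + q)
    + 3 * n * (3 / 2 * n - 1) * (p' + q') + 6 * n * q + 3 * n * p' + 2 * x * q'

end MaxCutReduction

/-! ### Cuts as sums of signs over ordered pairs -/

namespace MaxCutReduction

/-! Encode a cut by signs ±1. An ordered pair of adjacent intervals with signs a, b contributes 1 -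
ab, and four times the cut size is the sum of these terms; the diagonal contributes nothing. Two
families that meet completely contribute the product of their sizes minus the product of their sign
sums, so a gadget enters only through its four sign sums x, y, z, t (left long, left short, right
long, right short). Inside, it gives 8pq + 4q² minus `gadgetLoss`, which vanishes when all left long
and right short intervals are opposite to all left short and right long ones. The total sign sum is
then 0, so a link interval covering the gadget gains the same on either side.

From G to G' (`le_sum_crossing_sides`): take every gadget without loss, put the right long intervals
of a vertex on its side σ and the link intervals starting there on -σ, and orient each E-gadget by
the third-manner source of its edge. The gains form `baseValue`, plus 8q' for each cut edge.

From G' to G (`exists_sides_of_cut`): let σ be the majority side of the right long intervals of each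
V-gadget; it exists because q is odd. A gadget may deviate from its optimum to favour link
intervals, but there are only K = 4m of those, and its loss pays for all they can gain from it
(`loss_bound`, `gadget_bound`). What remains is a finite check for each edge (`edge_bound`): beyond
the base value an edge yields 8q' only if σ cuts it.

The pairs of link intervals are never evaluated. Their contribution lies between 0 and 16m² = 36n²,
which is less than the step 8q' = 80n² + 8 between consecutive values of the bound, so it cannot
simulate another cut edge. -/

/-- Twice the contribution to a cut of an ordered pair of intervals `I`, `J` that lie on the
sides `a`, `b = ± 1`, as a summand over ordered pairs. -/
def crossing (I J : ℕ × ℕ) (a b : ℤ) : ℤ :=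
  if I.1 ≤ J.2 ∧ J.1 ≤ I.2 then 1 - a * b else 0

lemma crossing_of_meet {I J : ℕ × ℕ} (h : I.1 ≤ J.2 ∧ J.1 ≤ I.2) (a b : ℤ) :
    crossing I J a b = 1 - a * b := if_pos h

lemma crossing_of_not_meet {I J : ℕ × ℕ} (h : ¬ (I.1 ≤ J.2 ∧ J.1 ≤ I.2)) (a b : ℤ) :
    crossing I J a b = 0 := if_neg h

lemma crossing_comm (I J : ℕ × ℕ) (a b : ℤ) : crossing I J a b = crossing J I b a := by
  unfold crossing
  simp only [and_comm, mul_comm]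

lemma one_sub_mul_nonneg {a b : ℤ} (ha : a = 1 ∨ a = -1) (hb : b = 1 ∨ b = -1) :
    0 ≤ 1 - a * b := by
  rcases ha with rfl | rfl <;> rcases hb with rfl | rfl <;> norm_num

lemma crossing_nonneg (I J : ℕ × ℕ) {a b : ℤ} (ha : a = 1 ∨ a = -1) (hb : b = 1 ∨ b = -1) :
    0 ≤ crossing I J a b := by
  unfold crossing
  split_ifs
  exacts [one_sub_mul_nonneg ha hb, le_rfl]

lemma crossing_le (I J : ℕ × ℕ) {a b : ℤ} (ha : a = 1 ∨ a = -1) (hb : b = 1 ∨ b = -1) :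
    crossing I J a b ≤ 1 - a * b := by
  unfold crossing
  split_ifs
  exacts [le_rfl, one_sub_mul_nonneg ha hb]

lemma sum_one_sub_mul {ι κ : Type*} [Fintype ι] [Fintype κ] (f : ι → ℤ) (g : κ → ℤ) :
    ∑ i, ∑ j, (1 - f i * g j) = Fintype.card ι * Fintype.card κ - (∑ i, f i) * ∑ j, g j := by
  simp [Finset.sum_sub_distrib, Finset.sum_mul_sum]

lemma sum_one_sub_const_mul {ι : Type*} [Fintype ι] (c : ℤ) (f : ι → ℤ) :
    ∑ i, (1 - c * f i) = Fintype.card ι - c * ∑ i, f i := by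
  simp [Finset.sum_sub_distrib, Finset.mul_sum]

/-- Four times the size of a cut as a sum over ordered pairs. -/
lemma four_mul_ncard_cut {W : Type*} [Fintype W] (H : SimpleGraph W) (A B : Set W)
    (hAB : A ∪ B = Set.univ) (hAB' : A ∩ B = ∅) (s : W → ℤ) (hA : ∀ a ∈ A, s a = 1)
    (hB : ∀ b ∈ B, s b = -1) (w : W → W → ℤ) (hw : ∀ a b, H.Adj a b → w a b = 1 - s a * s b)
    (hw' : ∀ a b, ¬ H.Adj a b → w a b = 0) :
    4 * (Set.ncard {e ∈ H.edgeSet | ∃ u ∈ A, ∃ v ∈ B, e = s(u, v)} : ℤ) = ∑ a, ∑ b, w a b := by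
  classical
  have hdisj : ∀ a, a ∈ A → a ∉ B := fun a ha hb => by
    have : a ∈ A ∩ B := ⟨ha, hb⟩
    simp [hAB'] at this
  have hcov : ∀ a, a ∈ A ∨ a ∈ B := fun a => by
    have : a ∈ A ∪ B := by simp [hAB]
    simpa using this
  have hset : {e ∈ H.edgeSet | ∃ u ∈ A, ∃ v ∈ B, e = s(u, v)} =
      (fun z : W × W => s(z.1, z.2)) ''
        ((Finset.univ.filter fun z : W × W => z.1 ∈ A ∧ z.2 ∈ B ∧ H.Adj z.1 z.2 :
          Finset (W × W)) : Set (W × W)) := by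
    ext e
    simp only [Set.mem_ofPred_eq, Finset.coe_filter, Finset.mem_univ, true_and, Set.mem_image,
      Prod.exists]
    constructor
    · rintro ⟨he, u, hu, v, hv, rfl⟩
      exact ⟨u, v, ⟨hu, hv, he⟩, rfl⟩
    · rintro ⟨u, v, ⟨hu, hv, he⟩, rfl⟩
      exact ⟨he, u, hu, v, hv, rfl⟩
  rw [hset, Set.InjOn.ncard_image, Set.ncard_coe_finset]
  -- A cut edge appears as two ordered pairs, each of weight 1 - (1)(-1) = 2.
  · have key : ∀ a b, w a b = 2 * ((if a ∈ A ∧ b ∈ B ∧ H.Adj a b then 1 else 0) +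
        (if b ∈ A ∧ a ∈ B ∧ H.Adj b a then 1 else 0)) := by
      intro a b
      by_cases hab : H.Adj a b
      · rw [hw a b hab]
        rcases hcov a with ha | ha <;> rcases hcov b with hb | hb
        · simp [hA a ha, hA b hb, hdisj a ha, hdisj b hb]
        · have hb' : b ∉ A := fun h => hdisj b h hb
          simp [hA a ha, hB b hb, ha, hb, hb', hab]
        · have ha' : a ∉ A := fun h => hdisj a h ha
          simp [hB a ha, hA b hb, ha, hb, ha', hab, hab.symm]
        · have hb' : b ∉ A := fun h => hdisj b h hb
          have ha' : a ∉ A := fun h => hdisj a h ha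
          simp [hB a ha, hB b hb, ha', hb']
      · rw [hw' a b hab]
        have hab' : ¬ H.Adj b a := fun h => hab h.symm
        simp [hab, hab']
    simp only [key, ← Finset.mul_sum, Finset.sum_add_distrib]
    rw [Finset.sum_comm (f := fun a b => if b ∈ A ∧ a ∈ B ∧ H.Adj b a then (1 : ℤ) else 0)]
    have : ∑ a, ∑ b, (if a ∈ A ∧ b ∈ B ∧ H.Adj a b then (1 : ℤ) else 0) =
        ((Finset.univ.filter fun z : W × W => z.1 ∈ A ∧ z.2 ∈ B ∧ H.Adj z.1 z.2).card : ℤ) := by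
      rw [← Fintype.sum_prod_type'
        (f := fun a b => if a ∈ A ∧ b ∈ B ∧ H.Adj a b then (1 : ℤ) else 0)]
      simp
    rw [this]
    ring
  · rintro ⟨u, v⟩ hz ⟨u', v'⟩ hz' h
    simp only [Finset.coe_filter, Finset.mem_univ, true_and, Set.mem_ofPred_eq] at hz hz'
    simp only [Sym2.eq_iff] at h
    rcases h with ⟨rfl, rfl⟩ | ⟨rfl, rfl⟩
    · rfl
    · exact absurd hz'.2.1 (hdisj _ hz.1)

/-! ### Contributions of a single gadget -/

section GadgetSums

variable {q p : ℕ}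

lemma Gadget.ends_bounds (o : ℕ) (g : Gadget q p) :
    o < (Gadget.ends o g).1 ∧ (Gadget.ends o g).1 ≤ (Gadget.ends o g).2 ∧
      (Gadget.ends o g).2 < o + gadgetWidth q p := by
  unfold gadgetWidth
  rcases g with (a | a) | (a | a) <;> have := a.isLt <;> simp only [Gadget.ends] <;> omega

/-- The signed number of left long intervals. -/
def leftLongSum (s : Gadget q p → ℤ) : ℤ := ∑ a, s (Gadget.leftLong a)
/-- The signed number of left short intervals. -/
def leftShortSum (s : Gadget q p → ℤ) : ℤ := ∑ a, s (Gadget.leftShort a)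
/-- The signed number of right long intervals. -/
def rightLongSum (s : Gadget q p → ℤ) : ℤ := ∑ a, s (Gadget.rightLong a)
/-- The signed number of right short intervals. -/
def rightShortSum (s : Gadget q p → ℤ) : ℤ := ∑ a, s (Gadget.rightShort a)
/-- The signed number of intervals of a gadget. -/
def gadgetSum (s : Gadget q p → ℤ) : ℤ :=
  leftLongSum s + leftShortSum s + rightLongSum s + rightShortSum s

/-- Four times the number of cut edges that a gadget misses compared to an optimal cut of it. -/
def gadgetLoss (s : Gadget q p → ℤ) : ℤ :=
  2 * (p * q + leftLongSum s * leftShortSum s) + 2 * (p * q + rightLongSum s * rightShortSum s) +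
    (leftLongSum s + rightLongSum s) ^ 2

lemma sum_gadget {M : Type*} [AddCommMonoid M] (f : Gadget q p → M) :
    ∑ g, f g = ((∑ a, f (Gadget.leftLong a)) + ∑ a, f (Gadget.leftShort a)) +
      ((∑ a, f (Gadget.rightLong a)) + ∑ a, f (Gadget.rightShort a)) := by
  simp only [Fintype.sum_sum_type]

lemma sum_block {ι κ : Type*} [Fintype ι] [Fintype κ] {I : ι → ℕ × ℕ} {J : κ → ℕ × ℕ}
    (h : ∀ i j, (I i).1 ≤ (J j).2 ∧ (J j).1 ≤ (I i).2) (f : ι → ℤ) (g : κ → ℤ) :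
    ∑ i, ∑ j, crossing (I i) (J j) (f i) (g j) =
      Fintype.card ι * Fintype.card κ - (∑ i, f i) * ∑ j, g j := by
  simp only [crossing_of_meet (h _ _), sum_one_sub_mul]

lemma sum_block_eq_zero {ι κ : Type*} [Fintype ι] [Fintype κ] {I : ι → ℕ × ℕ} {J : κ → ℕ × ℕ}
    (h : ∀ i j, ¬ ((I i).1 ≤ (J j).2 ∧ (J j).1 ≤ (I i).2)) (f : ι → ℤ) (g : κ → ℤ) :
    ∑ i, ∑ j, crossing (I i) (J j) (f i) (g j) = 0 := by
  simp only [crossing_of_not_meet (h _ _), Finset.sum_const_zero]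

lemma sum_block_diag {ι : Type*} [Fintype ι] {I : ι → ℕ × ℕ}
    (h : ∀ i j, i ≠ j → ¬ ((I i).1 ≤ (I j).2 ∧ (I j).1 ≤ (I i).2)) (f : ι → ℤ)
    (hf : ∀ i, f i = 1 ∨ f i = -1) :
    ∑ i, ∑ j, crossing (I i) (I j) (f i) (f j) = 0 := by
  refine Finset.sum_eq_zero fun i _ => Finset.sum_eq_zero fun j _ => ?_
  by_cases hij : i = j
  · subst hij
    unfold crossing
    rcases hf i with h1 | h1 <;> simp [h1]
  · exact crossing_of_not_meet (h i j hij) _ _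

/-- The contribution of the pairs inside a gadget. -/
lemma sum_crossing_gadget (o : ℕ) (s : Gadget q p → ℤ) (hs : ∀ g, s g = 1 ∨ s g = -1) :
    ∑ g, ∑ g', crossing (Gadget.ends o g) (Gadget.ends o g') (s g) (s g') =
      8 * p * q + 4 * q ^ 2 - gadgetLoss s := by
  -- Of the sixteen blocks, eight meet completely. A block of short intervals with itself meets only
  -- on the diagonal, where 1 - s² = 0; the other six are empty.
  simp only [sum_gadget, Finset.sum_add_distrib]
  rw [sum_block (I := fun a : Fin q => Gadget.ends o (Gadget.leftLong a : Gadget q p))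
      (J := fun a : Fin q => Gadget.ends o (Gadget.leftLong a : Gadget q p))
      (f := fun a => s (Gadget.leftLong a)) (g := fun a => s (Gadget.leftLong a)),
    sum_block (I := fun a : Fin q => Gadget.ends o (Gadget.leftLong a : Gadget q p))
      (J := fun a : Fin p => Gadget.ends o (Gadget.leftShort a : Gadget q p))
      (f := fun a => s (Gadget.leftLong a)) (g := fun a => s (Gadget.leftShort a)),
    sum_block (I := fun a : Fin q => Gadget.ends o (Gadget.leftLong a : Gadget q p))
      (J := fun a : Fin q => Gadget.ends o (Gadget.rightLong a : Gadget q p))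
      (f := fun a => s (Gadget.leftLong a)) (g := fun a => s (Gadget.rightLong a)),
    sum_block_eq_zero (I := fun a : Fin q => Gadget.ends o (Gadget.leftLong a : Gadget q p))
      (J := fun a : Fin p => Gadget.ends o (Gadget.rightShort a : Gadget q p))
      (f := fun a => s (Gadget.leftLong a)) (g := fun a => s (Gadget.rightShort a)),
    sum_block (I := fun a : Fin p => Gadget.ends o (Gadget.leftShort a : Gadget q p))
      (J := fun a : Fin q => Gadget.ends o (Gadget.leftLong a : Gadget q p))
      (f := fun a => s (Gadget.leftShort a)) (g := fun a => s (Gadget.leftLong a)),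
    sum_block_diag (I := fun a : Fin p => Gadget.ends o (Gadget.leftShort a : Gadget q p))
      (f := fun a => s (Gadget.leftShort a)) (hf := fun _ => hs _),
    sum_block_eq_zero (I := fun a : Fin p => Gadget.ends o (Gadget.leftShort a : Gadget q p))
      (J := fun a : Fin q => Gadget.ends o (Gadget.rightLong a : Gadget q p))
      (f := fun a => s (Gadget.leftShort a)) (g := fun a => s (Gadget.rightLong a)),
    sum_block_eq_zero (I := fun a : Fin p => Gadget.ends o (Gadget.leftShort a : Gadget q p))
      (J := fun a : Fin p => Gadget.ends o (Gadget.rightShort a : Gadget q p))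
      (f := fun a => s (Gadget.leftShort a)) (g := fun a => s (Gadget.rightShort a)),
    sum_block (I := fun a : Fin q => Gadget.ends o (Gadget.rightLong a : Gadget q p))
      (J := fun a : Fin q => Gadget.ends o (Gadget.leftLong a : Gadget q p))
      (f := fun a => s (Gadget.rightLong a)) (g := fun a => s (Gadget.leftLong a)),
    sum_block_eq_zero (I := fun a : Fin q => Gadget.ends o (Gadget.rightLong a : Gadget q p))
      (J := fun a : Fin p => Gadget.ends o (Gadget.leftShort a : Gadget q p))
      (f := fun a => s (Gadget.rightLong a)) (g := fun a => s (Gadget.leftShort a)),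
    sum_block (I := fun a : Fin q => Gadget.ends o (Gadget.rightLong a : Gadget q p))
      (J := fun a : Fin q => Gadget.ends o (Gadget.rightLong a : Gadget q p))
      (f := fun a => s (Gadget.rightLong a)) (g := fun a => s (Gadget.rightLong a)),
    sum_block (I := fun a : Fin q => Gadget.ends o (Gadget.rightLong a : Gadget q p))
      (J := fun a : Fin p => Gadget.ends o (Gadget.rightShort a : Gadget q p))
      (f := fun a => s (Gadget.rightLong a)) (g := fun a => s (Gadget.rightShort a)),
    sum_block_eq_zero (I := fun a : Fin p => Gadget.ends o (Gadget.rightShort a : Gadget q p))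
      (J := fun a : Fin q => Gadget.ends o (Gadget.leftLong a : Gadget q p))
      (f := fun a => s (Gadget.rightShort a)) (g := fun a => s (Gadget.leftLong a)),
    sum_block_eq_zero (I := fun a : Fin p => Gadget.ends o (Gadget.rightShort a : Gadget q p))
      (J := fun a : Fin p => Gadget.ends o (Gadget.leftShort a : Gadget q p))
      (f := fun a => s (Gadget.rightShort a)) (g := fun a => s (Gadget.leftShort a)),
    sum_block (I := fun a : Fin p => Gadget.ends o (Gadget.rightShort a : Gadget q p))
      (J := fun a : Fin q => Gadget.ends o (Gadget.rightLong a : Gadget q p))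
      (f := fun a => s (Gadget.rightShort a)) (g := fun a => s (Gadget.rightLong a)),
    sum_block_diag (I := fun a : Fin p => Gadget.ends o (Gadget.rightShort a : Gadget q p))
      (f := fun a => s (Gadget.rightShort a)) (hf := fun _ => hs _)]
  · simp only [gadgetLoss, leftLongSum, leftShortSum, rightLongSum, rightShortSum,
      Fintype.card_fin]
    ring
  all_goals
    intro a b
    have := a.isLt
    have := b.isLt
    simp only [Gadget.ends, ne_eq, Fin.ext_iff]
    omega

/-- An interval to the left or to the right of a gadget. -/
lemma sum_crossing_gadget_of_disjoint (o : ℕ) (s : Gadget q p → ℤ) {I : ℕ × ℕ} (c : ℤ)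
    (h : I.2 ≤ o ∨ o + gadgetWidth q p ≤ I.1) :
    ∑ g, crossing I (Gadget.ends o g) c (s g) = 0 := by
  refine Finset.sum_eq_zero fun g _ => crossing_of_not_meet ?_ _ _
  have := Gadget.ends_bounds o g
  omega

/-- An interval that covers a gadget. -/
lemma sum_crossing_gadget_of_cover (o : ℕ) (s : Gadget q p → ℤ) {I : ℕ × ℕ} (c : ℤ)
    (h : I.1 ≤ o) (h' : o + gadgetWidth q p ≤ I.2) :
    ∑ g, crossing I (Gadget.ends o g) c (s g) = 2 * p + 2 * q - c * gadgetSum s := by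
  have : ∀ g : Gadget q p, crossing I (Gadget.ends o g) c (s g) = 1 - c * s g := fun g =>
    crossing_of_meet (by have := Gadget.ends_bounds o g; omega) _ _
  simp only [this, sum_one_sub_const_mul, sum_gadget, Fintype.card_sum, Fintype.card_fin, gadgetSum,
    leftLongSum, leftShortSum, rightLongSum, rightShortSum]
  push_cast
  ring

/-- An interval that starts in a gadget, to the right of its short intervals. -/
lemma sum_crossing_gadget_of_start (o : ℕ) (s : Gadget q p → ℤ) {I : ℕ × ℕ} (c : ℤ)
    (h : o + q + 4 * p + 3 ≤ I.1) (h₁ : I.1 ≤ o + q + 4 * p + 4)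
    (h' : o + gadgetWidth q p ≤ I.2) :
    ∑ g, crossing I (Gadget.ends o g) c (s g) = q - c * rightLongSum s := by
  unfold gadgetWidth at h'
  have e₁ : ∀ a, crossing I (Gadget.ends o (Gadget.leftLong a : Gadget q p)) c
      (s (Gadget.leftLong a)) = 0 := fun a =>
    crossing_of_not_meet (by have := a.isLt; simp only [Gadget.ends]; omega) _ _
  have e₂ : ∀ a, crossing I (Gadget.ends o (Gadget.leftShort a : Gadget q p)) c
      (s (Gadget.leftShort a)) = 0 := fun a =>
    crossing_of_not_meet (by have := a.isLt; simp only [Gadget.ends]; omega) _ _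
  have e₃ : ∀ a, crossing I (Gadget.ends o (Gadget.rightLong a : Gadget q p)) c
      (s (Gadget.rightLong a)) = 1 - c * s (Gadget.rightLong a) := fun a =>
    crossing_of_meet (by have := a.isLt; simp only [Gadget.ends]; omega) _ _
  have e₄ : ∀ a, crossing I (Gadget.ends o (Gadget.rightShort a : Gadget q p)) c
      (s (Gadget.rightShort a)) = 0 := fun a =>
    crossing_of_not_meet (by have := a.isLt; simp only [Gadget.ends]; omega) _ _
  simp only [sum_gadget, e₁, e₂, e₃, e₄, sum_one_sub_const_mul, Fintype.card_fin, rightLongSum,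
    Finset.sum_const_zero]
  ring

/-- An interval that ends in a gadget, to the left of its short intervals. -/
lemma sum_crossing_gadget_of_end_second (o : ℕ) (s : Gadget q p → ℤ) {I : ℕ × ℕ} (c : ℤ)
    (h : I.1 ≤ o) (h' : I.2 = o + q) :
    ∑ g, crossing I (Gadget.ends o g) c (s g) = q - c * leftLongSum s := by
  have e₁ : ∀ a, crossing I (Gadget.ends o (Gadget.leftLong a : Gadget q p)) c
      (s (Gadget.leftLong a)) = 1 - c * s (Gadget.leftLong a) := fun a =>
    crossing_of_meet (by have := a.isLt; simp only [Gadget.ends]; omega) _ _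
  have e₂ : ∀ a, crossing I (Gadget.ends o (Gadget.leftShort a : Gadget q p)) c
      (s (Gadget.leftShort a)) = 0 := fun a =>
    crossing_of_not_meet (by have := a.isLt; simp only [Gadget.ends]; omega) _ _
  have e₃ : ∀ a, crossing I (Gadget.ends o (Gadget.rightLong a : Gadget q p)) c
      (s (Gadget.rightLong a)) = 0 := fun a =>
    crossing_of_not_meet (by have := a.isLt; simp only [Gadget.ends]; omega) _ _
  have e₄ : ∀ a, crossing I (Gadget.ends o (Gadget.rightShort a : Gadget q p)) c
      (s (Gadget.rightShort a)) = 0 := fun a =>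
    crossing_of_not_meet (by have := a.isLt; simp only [Gadget.ends]; omega) _ _
  simp only [sum_gadget, e₁, e₂, e₃, e₄, sum_one_sub_const_mul, Fintype.card_fin, leftLongSum,
    Finset.sum_const_zero]
  ring

/-- An interval that ends in a gadget, between its left and its right short intervals. -/
lemma sum_crossing_gadget_of_end_third (o : ℕ) (s : Gadget q p → ℤ) {I : ℕ × ℕ} (c : ℤ)
    (h : I.1 ≤ o) (h' : I.2 = o + q + 2 * p + 1) :
    ∑ g, crossing I (Gadget.ends o g) c (s g) =
      q + p - c * (leftLongSum s + leftShortSum s) := by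
  have e₁ : ∀ a, crossing I (Gadget.ends o (Gadget.leftLong a : Gadget q p)) c
      (s (Gadget.leftLong a)) = 1 - c * s (Gadget.leftLong a) := fun a =>
    crossing_of_meet (by have := a.isLt; simp only [Gadget.ends]; omega) _ _
  have e₂ : ∀ a, crossing I (Gadget.ends o (Gadget.leftShort a : Gadget q p)) c
      (s (Gadget.leftShort a)) = 1 - c * s (Gadget.leftShort a) := fun a =>
    crossing_of_meet (by have := a.isLt; simp only [Gadget.ends]; omega) _ _
  have e₃ : ∀ a, crossing I (Gadget.ends o (Gadget.rightLong a : Gadget q p)) c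
      (s (Gadget.rightLong a)) = 0 := fun a =>
    crossing_of_not_meet (by have := a.isLt; simp only [Gadget.ends]; omega) _ _
  have e₄ : ∀ a, crossing I (Gadget.ends o (Gadget.rightShort a : Gadget q p)) c
      (s (Gadget.rightShort a)) = 0 := fun a =>
    crossing_of_not_meet (by have := a.isLt; simp only [Gadget.ends]; omega) _ _
  simp only [sum_gadget, e₁, e₂, e₃, e₄, sum_one_sub_const_mul, Fintype.card_fin, leftLongSum,
    leftShortSum, Finset.sum_const_zero]
  ring

end GadgetSums

/-! ### The loss of a gadget against its imbalance -/

/-- With A = q - x and B = p + y, the deviations from the optimum x = q, y = -p, the right side is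
pq + xy, the loss of one half of a gadget. For fixed A the claim is affine in B, so it suffices to
check B = 0 and B = 2p; `h1` and `h3` are these two cases, weighted by 2p - B and B. The extra term
qA is needed when both halves have the same majority. -/
lemma half_loss_bound {q p K A B : ℤ} (hK : 0 ≤ K) (hq : 5 * K ≤ q) (hp : 2 * q ≤ p)
    (hA : 0 ≤ A) (hA' : A ≤ q) (hB : 0 ≤ B) (hB' : B ≤ 2 * p) :
    K * (A + B) + q * A ≤ q * B + p * A - A * B := by
  have hq0 : 0 ≤ q := by linarith
  rcases eq_or_lt_of_le (show 0 ≤ p by linarith) with hp0 | hp0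
  · have : q = 0 := by linarith
    have : B = 0 := by linarith
    have : A = 0 := by linarith
    subst_vars; simp
  have h1 : 0 ≤ (2 * p - B) * (A * (p - K - q)) :=
    mul_nonneg (by linarith) (mul_nonneg hA (by linarith))
  have h3 : 0 ≤ 2 * p * q - p * A - K * A - 2 * p * K - q * A := by
    have : (p + K + q) * A ≤ (p + K + q) * q :=
      mul_le_mul_of_nonneg_left hA' (by linarith)
    nlinarith [mul_nonneg hK hq0, mul_nonneg hK hp0.le, mul_nonneg hq0 (sub_nonneg.2 hp),
      mul_nonneg hK (sub_nonneg.2 hp), mul_nonneg hq0 (sub_nonneg.2 hq),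
      mul_nonneg hp0.le (sub_nonneg.2 hq)]
  have h2 := mul_nonneg hB h3
  have : 0 ≤ (2 * p) * (q * B + p * A - A * B - (K * (A + B) + q * A)) := by linarith
  have := nonneg_of_mul_nonneg_right this (by linarith : 0 < 2 * p)
  linarith

lemma loss_bound_of_pos {q p K x y z t : ℤ} (hK : 0 ≤ K) (hq : 5 * K ≤ q) (hp : 2 * q ≤ p)
    (hpq : 4 * (K * (p - q)) ≤ 3 * q ^ 2)
    (hx : 0 < x) (hx' : x ≤ q) (hz : z ≠ 0) (hz₁ : -q ≤ z) (hz₂ : z ≤ q)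
    (hy : -p ≤ y) (hy' : y ≤ p) (ht : -p ≤ t) (ht' : t ≤ p) :
    2 * K * |x + y + z + t| ≤ 2 * (p * q + x * y) + 2 * (p * q + z * t) + (x + z) ^ 2 ∧
    2 * K * (q - x + p + y) ≤ 2 * (p * q + x * y) + 2 * (p * q + z * t) + (x + z) ^ 2 := by
  have f₁ := half_loss_bound (A := q - x) (B := p + y) hK hq hp (by linarith) (by linarith)
    (by linarith) (by linarith)
  have g₁ : 0 ≤ q * (q - x) := mul_nonneg (by linarith) (by linarith)
  rcases lt_or_gt_of_ne hz with h | h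
  · have f₂ := half_loss_bound (A := q + z) (B := p - t) hK hq hp (by linarith) (by linarith)
      (by linarith) (by linarith)
    have g₂ : 0 ≤ q * (q + z) := mul_nonneg (by linarith) (by linarith)
    have g₃ : 0 ≤ K * (q + z + (p - t)) := mul_nonneg hK (by linarith)
    constructor
    · have : |x + y + z + t| ≤ (q - x) + (p + y) + (q + z) + (p - t) := by
        rw [abs_le]; constructor <;> linarith
      nlinarith [mul_le_mul_of_nonneg_left this hK, sq_nonneg (x + z)]
    · nlinarith [sq_nonneg (x + z)]
  · have f₂ := half_loss_bound (A := q - z) (B := p + t) hK hq hp (by linarith) (by linarith)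
      (by linarith) (by linarith)
    have g₂ : 0 ≤ q * (q - z) := mul_nonneg (by linarith) (by linarith)
    have g₃ : 0 ≤ K * (q - z + (p + t)) := mul_nonneg hK (by linarith)
    constructor
    -- Both long families lie mostly on the same side: even without deviations the imbalance is 2(p
    -- - q). It is paid for by the uncut pairs of long intervals: with D = 2q - x - z, the terms qA
    -- and the square give 2qD + (2q - D)² = 3q² + (q - D)², and `hpq` applies.
    · have : |x + y + z + t| ≤ (q - x) + (p + y) + (q - z) + (p + t) + 2 * (p - q) := by
        rw [abs_le]; constructor <;> linarith
      nlinarith [mul_le_mul_of_nonneg_left this hK, sq_nonneg (x + z - q)]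
    · nlinarith [sq_nonneg (x + z)]

/-- The loss of a gadget outweighs what its imbalances can give to `K` link intervals. -/
lemma loss_bound {q p K x y z t τ : ℤ} (hK : 0 ≤ K) (hq : 5 * K ≤ q) (hp : 2 * q ≤ p)
    (hpq : 4 * (K * (p - q)) ≤ 3 * q ^ 2) (hτ : τ = 1 ∨ τ = -1)
    (hx : 0 < τ * x) (hx₁ : -q ≤ x) (hx₂ : x ≤ q) (hz : z ≠ 0) (hz₁ : -q ≤ z) (hz₂ : z ≤ q)
    (hy : -p ≤ y) (hy' : y ≤ p) (ht : -p ≤ t) (ht' : t ≤ p) :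
    2 * K * |x + y + z + t| ≤ 2 * (p * q + x * y) + 2 * (p * q + z * t) + (x + z) ^ 2 ∧
    2 * K * (q - τ * x + p + τ * y) ≤
      2 * (p * q + x * y) + 2 * (p * q + z * t) + (x + z) ^ 2 := by
  rcases hτ with rfl | rfl
  · simpa using loss_bound_of_pos hK hq hp hpq (by linarith) hx₂ hz hz₁ hz₂ hy hy' ht ht'
  -- Exchanging the two sides of the cut changes all four signs and preserves the loss.
  · have := loss_bound_of_pos (x := -x) (y := -y) (z := -z) (t := -t) hK hq hp hpq
      (by linarith) (by linarith) (by simpa using hz) (by linarith) (by linarith)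
      (by linarith) (by linarith) (by linarith) (by linarith)
    have e : |-x + -y + -z + -t| = |x + y + z + t| := by
      rw [← abs_neg]; congr 1; ring
    rw [e] at this
    constructor
    · linarith [this.1]
    · linarith [this.2]

/-! ### Sums of signs -/

section Signs

variable {ι : Type*} [Fintype ι] {f : ι → ℤ}

lemma neg_card_le_sum_signs (hf : ∀ i, f i = 1 ∨ f i = -1) : -(Fintype.card ι : ℤ) ≤ ∑ i, f i := by
  have : ∑ _i : ι, (-1 : ℤ) ≤ ∑ i, f i :=
    Finset.sum_le_sum fun i _ => by rcases hf i with h | h <;> simp [h]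
  simpa using this

lemma sum_signs_le_card (hf : ∀ i, f i = 1 ∨ f i = -1) : ∑ i, f i ≤ Fintype.card ι := by
  have : ∑ i, f i ≤ ∑ _i : ι, (1 : ℤ) :=
    Finset.sum_le_sum fun i _ => by rcases hf i with h | h <;> simp [h]
  simpa using this

/-- An odd number of signs has an odd sum. Hence the long intervals of one half of a gadget always
have a majority side. -/
lemma sum_signs_ne_zero (hf : ∀ i, f i = 1 ∨ f i = -1) (hι : Odd (Fintype.card ι)) :
    ∑ i, f i ≠ 0 := by
  have : (2 : ℤ) ∣ ∑ i, (f i - 1) :=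
    Finset.dvd_sum fun i _ => by rcases hf i with h | h <;> simp [h]
  simp only [Finset.sum_sub_distrib, Finset.sum_const, Finset.card_univ, nsmul_eq_mul,
    mul_one] at this
  obtain ⟨k, hk⟩ := hι
  intro h0
  rw [h0, hk] at this
  omega

lemma exists_sign_mul_pos {x : ℤ} (hx : x ≠ 0) : ∃ τ : ℤ, (τ = 1 ∨ τ = -1) ∧ 0 < τ * x := by
  rcases lt_or_gt_of_ne hx with h | h
  · exact ⟨-1, Or.inr rfl, by linarith⟩
  · exact ⟨1, Or.inl rfl, by linarith⟩

end Signs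

/-! ### Sums over gadget positions -/

section FinSums

lemma two_mul_sum_fin (n : ℕ) : 2 * ∑ i : Fin n, (i : ℤ) = n * (n - 1) := by
  induction n with
  | zero => simp
  | succ k ih =>
    rw [Fin.sum_univ_castSucc, mul_add]
    simp only [Fin.val_castSucc, Fin.val_last, ih]
    push_cast
    ring

/-- Totals what a link interval gets from the V-gadgets: it covers those to the right of its source
`a`. -/
lemma sum_of_lt_or_eq {n : ℕ} (a : Fin n) (C : ℤ) (f : Fin n → ℤ) :
    ∑ i, (if a < i then C else if a = i then f i else 0) = (n - 1 - a) * C + f a := by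
  have : ∀ i, (if a < i then C else if a = i then f i else 0) =
      (if a < i then C else 0) + (if a = i then f i else 0) := by
    intro i
    split_ifs with h₁ h₂ <;> simp_all
  simp only [this, Finset.sum_add_distrib, Finset.sum_ite_eq, Finset.mem_univ, if_true,
    ← Finset.sum_filter, Finset.sum_const]
  have hc : (Finset.univ.filter fun i => a < i).card = n - 1 - a := by
    rw [← Fin.card_Ioi a]
    congr 1
    ext
    simp
  have := a.isLt
  rw [hc, nsmul_eq_mul]
  congr 2
  omega

/-- The counterpart for the E-gadgets: those to the left of the final one `a` are covered. -/
lemma sum_of_gt_or_eq {n : ℕ} (a : Fin n) (C : ℤ) (f : Fin n → ℤ) :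
    ∑ i, (if i < a then C else if i = a then f i else 0) = a * C + f a := by
  have : ∀ i, (if i < a then C else if i = a then f i else 0) =
      (if i < a then C else 0) + (if i = a then f i else 0) := by
    intro i
    split_ifs with h₁ h₂ <;> simp_all
  simp only [this, Finset.sum_add_distrib, Finset.sum_ite_eq', Finset.mem_univ, if_true,
    ← Finset.sum_filter, Finset.sum_const]
  have hc : (Finset.univ.filter fun i => i < a).card = a := by
    rw [← Fin.card_Iio a]
    congr 1
    ext
    simp
  rw [hc, nsmul_eq_mul]

lemma sum_manner (f : Manner → ℤ) : ∑ t, f t = f Manner.second + f Manner.third := by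
  have : (Finset.univ : Finset Manner) = {Manner.second, Manner.third} := rfl
  rw [this, Finset.sum_pair (by decide)]

end FinSums

/-! ### Edges and their ends in the vertex ordering -/

section Edges

variable {V : Type*} {G : SimpleGraph V} {n m : ℕ} (v : Fin n ≃ V) (e : Fin m ≃ G.edgeSet)

/-- The two ends of an edge in the vertex ordering. -/
lemma exists_edge_eq (j : Fin m) : ∃ i k : Fin n, i < k ∧ (e j : Sym2 V) = s(v i, v k) ∧
    linkSource v e j Manner.second = i ∧ linkSource v e j Manner.third = k := by
  unfold linkSource
  obtain ⟨z, hz⟩ := e j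
  simp only
  induction z using Sym2.ind with
  | _ a b =>
    have hab : a ≠ b := G.ne_of_adj hz
    have hne : v.symm a ≠ v.symm b := fun h => hab (v.symm.injective h)
    rcases lt_or_gt_of_ne hne with h | h
    · exact ⟨v.symm a, v.symm b, h, by simp, by simp [h.le], by simp [h.le]⟩
    · exact ⟨v.symm b, v.symm a, h, by simp [Sym2.eq_swap], by simp [h.le], by simp [h.le]⟩

lemma linkSource_second_lt (j : Fin m) :
    linkSource v e j Manner.second < linkSource v e j Manner.third := by
  obtain ⟨i, k, h, -, hi, hk⟩ := exists_edge_eq v e j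
  rwa [hi, hk]

lemma coe_edge_eq (j : Fin m) : (e j : Sym2 V) =
    s(v (linkSource v e j Manner.second), v (linkSource v e j Manner.third)) := by
  obtain ⟨i, k, h, he, hi, hk⟩ := exists_edge_eq v e j
  rwa [hi, hk]

/-- Double counting of incident vertex-edge pairs: each vertex lies on d edges. -/
lemma sum_linkSource [Fintype V] [DecidableRel G.Adj] {d : ℕ} (hG : G.IsRegularOfDegree d)
    (h : Fin n → ℤ) :
    ∑ j, (h (linkSource v e j Manner.second) + h (linkSource v e j Manner.third)) =
      d * ∑ i, h i := by
  classical
  have h₁ : ∀ j, h (linkSource v e j Manner.second) + h (linkSource v e j Manner.third) =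
      ∑ i, if v i ∈ (e j : Sym2 V) then h i else 0 := by
    intro j
    have hlt := linkSource_second_lt v e j
    rw [coe_edge_eq v e j]
    simp only [Sym2.mem_iff, v.injective.eq_iff]
    rw [← Finset.sum_filter, Finset.filter_or, Finset.filter_eq', Finset.filter_eq',
      if_pos (Finset.mem_univ _), if_pos (Finset.mem_univ _), Finset.sum_union, Finset.sum_singleton,
      Finset.sum_singleton]
    simpa using hlt.ne
  simp only [h₁]
  rw [Finset.sum_comm, Finset.mul_sum]
  refine Finset.sum_congr rfl fun i _ => ?_
  rw [e.sum_comp (fun z : G.edgeSet => if v i ∈ (z : Sym2 V) then h i else 0),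
    ← Finset.sum_filter, Finset.sum_const, nsmul_eq_mul]
  congr 2
  rw [← hG.degree_eq (v i), ← G.card_incidenceFinset_eq_degree, G.incidenceFinset_eq_filter]
  refine Finset.card_bij (fun z _ => (z : Sym2 V)) ?_ ?_ ?_
  · rintro ⟨z, hz⟩ h
    simpa [hz] using h
  · rintro ⟨z, hz⟩ - ⟨z', hz'⟩ - h
    exact Subtype.ext h
  · intro z hz
    simp only [Finset.mem_filter, SimpleGraph.mem_edgeFinset] at hz
    exact ⟨⟨z, hz.1⟩, by simpa using hz.2, rfl⟩

lemma two_mul_card_edges [Fintype V] [DecidableRel G.Adj] {d : ℕ} (hG : G.IsRegularOfDegree d)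
    (v : Fin n ≃ V) (e : Fin m ≃ G.edgeSet) : 2 * m = d * n := by
  have := sum_linkSource v e hG (fun _ => 1)
  simp only [Finset.sum_const, Finset.card_univ, Fintype.card_fin, nsmul_eq_mul, mul_one] at this
  zify
  linarith

lemma ncard_cut_eq {A B : Set V} (hAB : A ∪ B = Set.univ) {σ : Fin n → ℤ}
    (hA : ∀ i, v i ∈ A → σ i = 1) (hB : ∀ i, v i ∈ B → σ i = -1) :
    Set.ncard {z ∈ G.edgeSet | ∃ a ∈ A, ∃ b ∈ B, z = s(a, b)} =
      (Finset.univ.filter fun j => σ (linkSource v e j Manner.second) ≠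
        σ (linkSource v e j Manner.third)).card := by
  have hcov : ∀ a, a ∈ A ∨ a ∈ B := fun a => by
    have : a ∈ A ∪ B := by simp [hAB]
    simpa using this
  have hset : {z ∈ G.edgeSet | ∃ a ∈ A, ∃ b ∈ B, z = s(a, b)} =
      (fun j => (e j : Sym2 V)) '' ((Finset.univ.filter fun j =>
        σ (linkSource v e j Manner.second) ≠ σ (linkSource v e j Manner.third) : Finset (Fin m)) :
        Set (Fin m)) := by
    ext z
    simp only [Set.mem_ofPred_eq, Finset.coe_filter, Finset.mem_univ, true_and, Set.mem_image]
    constructor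
    · rintro ⟨hz, a, ha, b, hb, rfl⟩
      refine ⟨e.symm ⟨_, hz⟩, ?_, by simp⟩
      have := coe_edge_eq v e (e.symm ⟨_, hz⟩)
      simp only [Equiv.apply_symm_apply, Sym2.eq_iff] at this
      generalize e.symm ⟨s(a, b), hz⟩ = j at *
      rcases this with ⟨h₁, h₂⟩ | ⟨h₁, h₂⟩
      all_goals
        rw [h₁] at ha
        rw [h₂] at hb
        rw [hA _ ha, hB _ hb]
        norm_num
    · rintro ⟨j, hj, rfl⟩
      refine ⟨(e j).2, ?_⟩
      rw [coe_edge_eq v e j]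
      rcases hcov (v (linkSource v e j Manner.second)) with h₁ | h₁ <;>
        rcases hcov (v (linkSource v e j Manner.third)) with h₂ | h₂
      · exact absurd ((hA _ h₁).trans (hA _ h₂).symm) hj
      · exact ⟨_, h₁, _, h₂, rfl⟩
      · exact ⟨_, h₂, _, h₁, Sym2.eq_swap⟩
      · exact absurd ((hB _ h₁).trans (hB _ h₂).symm) hj
  rw [hset, Set.InjOn.ncard_image, Set.ncard_coe_finset]
  intro j _ k _ h
  exact e.injective (Subtype.ext h)

end Edges

/-! ### Disjointness of different gadgets -/

section Offsets

lemma vOffset_add_le {n : ℕ} {i k : Fin n} (h : i < k) :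
    vOffset n i + gadgetWidth (vLong n) (vShort n) ≤ vOffset n k := by
  unfold vOffset
  rw [← Nat.succ_mul]
  exact Nat.mul_le_mul_right _ h

lemma vOffset_add_le_eOffset {n m : ℕ} (i : Fin n) (j : Fin m) :
    vOffset n i + gadgetWidth (vLong n) (vShort n) ≤ eOffset n j := by
  unfold vOffset eOffset
  rw [← Nat.succ_mul]
  exact (Nat.mul_le_mul_right _ i.isLt).trans (Nat.le_add_right _ _)

lemma eOffset_add_le {n m : ℕ} {j k : Fin m} (h : j < k) :
    eOffset n j + gadgetWidth (eLong n) (eShort n) ≤ eOffset n k := by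
  unfold eOffset
  rw [add_assoc, ← Nat.succ_mul]
  exact Nat.add_le_add_left (Nat.mul_le_mul_right _ h) _

/-- The contribution of the pairs in a family of pairwise disjoint gadgets. -/
lemma sum_crossing_gadgets {ι : Type*} [Fintype ι] {q p : ℕ} (o : ι → ℕ)
    (ho : ∀ i k, i ≠ k → o i + gadgetWidth q p ≤ o k ∨ o k + gadgetWidth q p ≤ o i)
    (s : ι × Gadget q p → ℤ) (hs : ∀ a, s a = 1 ∨ s a = -1) :
    ∑ a, ∑ b, crossing (Gadget.ends (o a.1) a.2) (Gadget.ends (o b.1) b.2) (s a) (s b) =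
      ∑ i, (8 * p * q + 4 * q ^ 2 - gadgetLoss fun g => s (i, g)) := by
  classical
  rw [Fintype.sum_prod_type]
  refine Finset.sum_congr rfl fun i _ => ?_
  rw [← sum_crossing_gadget (o i) _ fun g => hs (i, g)]
  refine Finset.sum_congr rfl fun g _ => ?_
  rw [Fintype.sum_prod_type, Finset.sum_eq_single i]
  · intro k _ hk
    refine sum_crossing_gadget_of_disjoint (o k) (fun g' => s (k, g')) _ ?_
    have := Gadget.ends_bounds (o i) g
    have := ho i k hk.symm
    simp only
    omega
  · simp

end Offsets

/-! ### Decomposition of the whole sum -/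

section Total

variable {V : Type*} {G : SimpleGraph V} {n m : ℕ} (v : Fin n ≃ V) (e : Fin m ≃ G.edgeSet)
  (s : Vertex n m → ℤ)

/-- The endpoints of a link interval. -/
abbrev linkEnds (l : Fin m × Manner × Fin 2) : ℕ × ℕ :=
  (linkLeft n (linkSource v e l.1 l.2.1) l.2.2, linkRight n l.1 l.2.1)

/-- The contribution of a link interval and a V-gadget. -/
def linkV (l : Fin m × Manner × Fin 2) (i : Fin n) : ℤ :=
  ∑ g, crossing (linkEnds v e l) (Gadget.ends (vOffset n i) g) (s (Sum.inr (Sum.inr l)))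
    (s (Sum.inl (i, g)))

/-- The contribution of a link interval and an E-gadget. -/
def linkE (l : Fin m × Manner × Fin 2) (k : Fin m) : ℤ :=
  ∑ g, crossing (linkEnds v e l) (Gadget.ends (eOffset n k) g) (s (Sum.inr (Sum.inr l)))
    (s (Sum.inr (Sum.inl (k, g))))

/-- The contribution of the pairs of link intervals. -/
def linkLink : ℤ :=
  ∑ l, ∑ l', crossing (linkEnds v e l) (linkEnds v e l') (s (Sum.inr (Sum.inr l)))
    (s (Sum.inr (Sum.inr l')))

/-- Different gadgets are disjoint, so only pairs within a gadget and pairs with a link interval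
remain. The factor 2 accounts for both orders of a link interval and a gadget interval. -/
lemma sum_crossing_eq (hs : ∀ a, s a = 1 ∨ s a = -1) :
    ∑ a, ∑ b, crossing (ends v e a) (ends v e b) (s a) (s b) =
      ∑ i, (8 * vShort n * vLong n + 4 * (vLong n) ^ 2 - gadgetLoss fun g => s (Sum.inl (i, g))) +
      ∑ k, (8 * eShort n * eLong n + 4 * (eLong n) ^ 2 -
        gadgetLoss fun g => s (Sum.inr (Sum.inl (k, g)))) +
      linkLink v e s + 2 * ∑ l, ((∑ i, linkV v e s l i) + ∑ k, linkE v e s l k) := by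
  simp only [Fintype.sum_sum_type, Finset.sum_add_distrib]
  have hVV := sum_crossing_gadgets (vOffset n) (fun i k h => by
      rcases lt_or_gt_of_ne h with h | h
      exacts [Or.inl (vOffset_add_le h), Or.inr (vOffset_add_le h)])
    (fun a => s (Sum.inl a)) fun a => hs _
  have hEE := sum_crossing_gadgets (fun k : Fin m => eOffset n k) (fun i k h => by
      rcases lt_or_gt_of_ne h with h | h
      exacts [Or.inl (eOffset_add_le h), Or.inr (eOffset_add_le h)])
    (fun a => s (Sum.inr (Sum.inl a))) fun a => hs _
  have hVE : ∑ a, ∑ b, crossing (ends v e (Sum.inl a)) (ends v e (Sum.inr (Sum.inl b)))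
      (s (Sum.inl a)) (s (Sum.inr (Sum.inl b))) = 0 := by
    refine sum_block_eq_zero (fun a b => ?_) _ _
    have := Gadget.ends_bounds (vOffset n a.1) a.2
    have := Gadget.ends_bounds (eOffset n b.1) b.2
    have := vOffset_add_le_eOffset a.1 b.1
    simp only [ends]
    omega
  have hEV : ∑ b, ∑ a, crossing (ends v e (Sum.inr (Sum.inl b))) (ends v e (Sum.inl a))
      (s (Sum.inr (Sum.inl b))) (s (Sum.inl a)) = 0 := by
    rw [Finset.sum_comm, ← hVE]
    simp only [crossing_comm]
  have hLV : ∑ l, ∑ a, crossing (ends v e (Sum.inr (Sum.inr l))) (ends v e (Sum.inl a))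
      (s (Sum.inr (Sum.inr l))) (s (Sum.inl a)) = ∑ l, ∑ i, linkV v e s l i := by
    simp only [Fintype.sum_prod_type (α₁ := Fin n)]
    rfl
  have hVL : ∑ a, ∑ l, crossing (ends v e (Sum.inl a)) (ends v e (Sum.inr (Sum.inr l)))
      (s (Sum.inl a)) (s (Sum.inr (Sum.inr l))) = ∑ l, ∑ i, linkV v e s l i := by
    rw [Finset.sum_comm, ← hLV]
    simp only [crossing_comm]
  have hLE : ∑ l, ∑ a, crossing (ends v e (Sum.inr (Sum.inr l))) (ends v e (Sum.inr (Sum.inl a)))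
      (s (Sum.inr (Sum.inr l))) (s (Sum.inr (Sum.inl a))) = ∑ l, ∑ k, linkE v e s l k := by
    refine Finset.sum_congr rfl fun l _ => ?_
    rw [Fintype.sum_prod_type]
    rfl
  have hEL : ∑ a, ∑ l, crossing (ends v e (Sum.inr (Sum.inl a))) (ends v e (Sum.inr (Sum.inr l)))
      (s (Sum.inr (Sum.inl a))) (s (Sum.inr (Sum.inr l))) = ∑ l, ∑ k, linkE v e s l k := by
    rw [Finset.sum_comm, ← hLE]
    simp only [crossing_comm]
  rw [hVE, hEV, hLV, hVL, hLE, hEL]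
  have hLL : ∑ l, ∑ l', crossing (ends v e (Sum.inr (Sum.inr l))) (ends v e (Sum.inr (Sum.inr l')))
      (s (Sum.inr (Sum.inr l))) (s (Sum.inr (Sum.inr l'))) = linkLink v e s := rfl
  rw [hLL]
  have hVV' : ∑ a, ∑ b, crossing (ends v e (Sum.inl a)) (ends v e (Sum.inl b))
      (s (Sum.inl a)) (s (Sum.inl b)) = _ := hVV
  have hEE' : ∑ a, ∑ b, crossing (ends v e (Sum.inr (Sum.inl a))) (ends v e (Sum.inr (Sum.inl b)))
      (s (Sum.inr (Sum.inl a))) (s (Sum.inr (Sum.inl b))) = _ := hEE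
  rw [hVV', hEE']
  ring

lemma linkLeft_le (i : Fin n) (c : Fin 2) : vOffset n i < linkLeft n i c ∧
    linkLeft n i c < vOffset n i + gadgetWidth (vLong n) (vShort n) := by
  have := c.isLt
  unfold linkLeft gadgetWidth vLong
  omega

lemma linkRight_bounds (j : Fin m) (t : Manner) : eOffset n j < linkRight n j t ∧
    linkRight n j t < eOffset n j + gadgetWidth (eLong n) (eShort n) := by
  cases t <;> simp only [linkRight, gadgetWidth, eLong] <;> constructor <;> omega

lemma linkV_eq (l : Fin m × Manner × Fin 2) (i : Fin n) :
    linkV v e s l i =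
      if linkSource v e l.1 l.2.1 < i then
        2 * vShort n + 2 * vLong n -
          s (Sum.inr (Sum.inr l)) * gadgetSum fun g => s (Sum.inl (i, g))
      else if linkSource v e l.1 l.2.1 = i then
        vLong n - s (Sum.inr (Sum.inr l)) * rightLongSum fun g => s (Sum.inl (i, g))
      else 0 := by
  have h₁ := linkLeft_le (linkSource v e l.1 l.2.1) l.2.2
  have h₂ := linkRight_bounds (n := n) l.1 l.2.1
  have h₃ := vOffset_add_le_eOffset i l.1
  split_ifs with h h'
  · have := vOffset_add_le h
    exact sum_crossing_gadget_of_cover _ (fun g => s (Sum.inl (i, g))) _ (by simp only; omega)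
      (by simp only; omega)
  · rw [← h'] at h₃ ⊢
    have := l.2.2.isLt
    exact sum_crossing_gadget_of_start _
      (fun g => s (Sum.inl (linkSource v e l.1 l.2.1, g))) _
      (by simp only [linkLeft]; omega) (by simp only [linkLeft]; omega) (by simp only; omega)
  · have := vOffset_add_le (lt_of_le_of_ne (not_lt.1 h) (Ne.symm h'))
    exact sum_crossing_gadget_of_disjoint _ (fun g => s (Sum.inl (i, g))) _
      (Or.inr (by simp only; omega))

lemma linkE_eq (l : Fin m × Manner × Fin 2) (k : Fin m) :
    linkE v e s l k =
      if k < l.1 then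
        2 * eShort n + 2 * eLong n -
          s (Sum.inr (Sum.inr l)) * gadgetSum fun g => s (Sum.inr (Sum.inl (k, g)))
      else if k = l.1 then
        match l.2.1 with
        | Manner.second =>
          eLong n - s (Sum.inr (Sum.inr l)) * leftLongSum fun g => s (Sum.inr (Sum.inl (k, g)))
        | Manner.third =>
          eLong n + eShort n - s (Sum.inr (Sum.inr l)) *
            (leftLongSum (fun g => s (Sum.inr (Sum.inl (k, g)))) +
              leftShortSum fun g => s (Sum.inr (Sum.inl (k, g))))
      else 0 := by
  have h₁ := linkLeft_le (linkSource v e l.1 l.2.1) l.2.2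
  have h₂ := linkRight_bounds (n := n) l.1 l.2.1
  have h₃ := vOffset_add_le_eOffset (linkSource v e l.1 l.2.1) k
  split_ifs with h h'
  · have := eOffset_add_le (n := n) h
    exact sum_crossing_gadget_of_cover _ (fun g => s (Sum.inr (Sum.inl (k, g)))) _
      (by simp only; omega) (by simp only; omega)
  · obtain ⟨j, t, c⟩ := l
    obtain rfl : k = j := h'
    cases t
    · exact sum_crossing_gadget_of_end_second _ (fun g => s (Sum.inr (Sum.inl (k, g)))) _
        (by simp only at *; omega) rfl
    · exact sum_crossing_gadget_of_end_third _ (fun g => s (Sum.inr (Sum.inl (k, g)))) _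
        (by simp only at *; omega) rfl
  · have := eOffset_add_le (n := n) (lt_of_le_of_ne (not_lt.1 h) (Ne.symm h'))
    exact sum_crossing_gadget_of_disjoint _ (fun g => s (Sum.inr (Sum.inl (k, g)))) _
      (Or.inl (by simp only; omega))

end Total

/-! ### What link intervals can gain from a gadget -/

/-- τ and σ are the majority sides of the left and right long intervals. M is the larger of the
total imbalance, which matters to covering intervals, and the deviation of the left half, which
matters to intervals ending here. A maximum suffices because a link interval meets a gadget in only
one way. At the start of a link no M is needed, since a majority already forces |z| ≥ 1. -/
lemma gadget_bound {q p : ℕ} {K : ℤ} (hK : 0 ≤ K) (hq : 5 * K ≤ q) (hp : 2 * q ≤ p)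
    (hpq : 4 * (K * (p - q)) ≤ 3 * (q : ℤ) ^ 2) (hodd : Odd q) (s : Gadget q p → ℤ)
    (hs : ∀ g, s g = 1 ∨ s g = -1) :
    ∃ M τ σ : ℤ, (τ = 1 ∨ τ = -1) ∧ (σ = 1 ∨ σ = -1) ∧ 2 * K * M ≤ gadgetLoss s ∧ 0 ≤ M ∧
      ∀ c : ℤ, (c = 1 ∨ c = -1) → -(c * gadgetSum s) ≤ M ∧
        q - c * rightLongSum s ≤ (if c = σ then (q - 1 : ℤ) else 2 * q) ∧
        q - c * leftLongSum s ≤ (if c = τ then 0 else (2 * q : ℤ)) + M ∧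
        q + p - c * (leftLongSum s + leftShortSum s) ≤ (if c = τ then (2 * p : ℤ) else 2 * q) + M := by
  have hx := neg_card_le_sum_signs fun a : Fin q => hs (Gadget.leftLong a)
  have hx' := sum_signs_le_card fun a : Fin q => hs (Gadget.leftLong a)
  have hx0 := sum_signs_ne_zero (fun a : Fin q => hs (Gadget.leftLong a)) (by simpa using hodd)
  have hy := neg_card_le_sum_signs fun a : Fin p => hs (Gadget.leftShort a)
  have hy' := sum_signs_le_card fun a : Fin p => hs (Gadget.leftShort a)
  have hz := neg_card_le_sum_signs fun a : Fin q => hs (Gadget.rightLong a)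
  have hz' := sum_signs_le_card fun a : Fin q => hs (Gadget.rightLong a)
  have hz0 := sum_signs_ne_zero (fun a : Fin q => hs (Gadget.rightLong a)) (by simpa using hodd)
  have ht := neg_card_le_sum_signs fun a : Fin p => hs (Gadget.rightShort a)
  have ht' := sum_signs_le_card fun a : Fin p => hs (Gadget.rightShort a)
  unfold gadgetSum gadgetLoss
  change _ ≤ leftLongSum s at hx
  change leftLongSum s ≤ _ at hx'
  change leftLongSum s ≠ 0 at hx0
  change _ ≤ leftShortSum s at hy
  change leftShortSum s ≤ _ at hy'
  change _ ≤ rightLongSum s at hz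
  change rightLongSum s ≤ _ at hz'
  change rightLongSum s ≠ 0 at hz0
  change _ ≤ rightShortSum s at ht
  change rightShortSum s ≤ _ at ht'
  rw [Fintype.card_fin] at hx hx' hy hy' hz hz' ht ht'
  generalize leftLongSum s = x at *
  generalize leftShortSum s = y at *
  generalize rightLongSum s = z at *
  generalize rightShortSum s = t at *
  obtain ⟨τ, hτ, hτx⟩ := exists_sign_mul_pos hx0
  obtain ⟨σ, hσ, hσz⟩ := exists_sign_mul_pos hz0
  obtain ⟨h₁, h₂⟩ := loss_bound hK hq (by exact_mod_cast hp) hpq hτ hτx hx hx' hz0 hz hz' hy hy'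
    ht ht'
  refine ⟨max |x + y + z + t| (q - τ * x + p + τ * y), τ, σ, hτ, hσ, ?_, ?_, ?_⟩
  · rcases max_choice |x + y + z + t| (q - τ * x + p + τ * y) with h | h <;> rw [h]
    exacts [h₁, h₂]
  · exact (abs_nonneg _).trans (le_max_left _ _)
  · intro c hc
    have m₁ := le_max_left |x + y + z + t| (q - τ * x + p + τ * y)
    have m₂ := le_max_right |x + y + z + t| (q - τ * x + p + τ * y)
    have a₁ := le_abs_self (x + y + z + t)
    have a₂ := neg_abs_le (x + y + z + t)
    generalize max |x + y + z + t| (q - τ * x + p + τ * y) = M at *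
    generalize |x + y + z + t| = S at *
    rcases hc with rfl | rfl <;> rcases hτ with rfl | rfl <;> rcases hσ with rfl | rfl <;>
      norm_num <;> omega

/-! ### Optimal sides for the link intervals of an edge -/

section Upper

variable {n : ℕ}

/-- Upper bound, up to the loss of the gadget, for what a link interval on the side `c` gets
in the V-gadget where it starts, whose right long intervals are mostly on the side `σ`. -/
def startBound (n : ℕ) (σ c : ℤ) : ℤ := if c = σ then (vLong n - 1 : ℤ) else 2 * vLong n

/-- Upper bound, up to the loss of the gadget, for what a link interval on the side `c` gets
in the E-gadget where it ends, whose left long intervals are mostly on the side `τ`. -/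
def endBound (n : ℕ) (τ : ℤ) : Manner → ℤ → ℤ
  | Manner.second, c => if c = τ then 0 else (2 * eLong n : ℤ)
  | Manner.third, c => if c = τ then (2 * eShort n : ℤ) else 2 * eLong n

lemma pow_three_ge_sq (n : ℕ) : n ^ 2 ≤ n ^ 3 := by
  rcases Nat.eq_zero_or_pos n with rfl | h
  · simp
  · exact Nat.pow_le_pow_right h (by norm_num)

lemma le_sq (n : ℕ) : n ≤ n ^ 2 := by nlinarith [Nat.zero_le n, Nat.le_mul_self n]

/-- Side -σ is the best choice: side σ costs q + 1 at the V-gadget, at least the difference 2q'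
between the two sides at the E-gadget. -/
lemma start_end_second_le {σ τ c : ℤ} (hσ : σ = 1 ∨ σ = -1) (hτ : τ = 1 ∨ τ = -1)
    (hc : c = 1 ∨ c = -1) : startBound n σ c + endBound n τ Manner.second c ≤
      2 * vLong n + if σ = τ then (2 * eLong n : ℤ) else 0 := by
  have h₁ : (n : ℤ) ^ 2 ≤ (n : ℤ) ^ 3 := by exact_mod_cast pow_three_ge_sq n
  have h₃ := sq_nonneg (n : ℤ)
  unfold startBound endBound vLong eLong
  rcases hσ with rfl | rfl <;> rcases hτ with rfl | rfl <;> rcases hc with rfl | rfl <;>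
    norm_num <;> omega

/-- As for the second manner; the difference at the E-gadget is now 2p' - 2q', still at most q + 1.
-/
lemma start_end_third_le {σ τ c : ℤ} (hσ : σ = 1 ∨ σ = -1) (hτ : τ = 1 ∨ τ = -1)
    (hc : c = 1 ∨ c = -1) : startBound n σ c + endBound n τ Manner.third c ≤
      2 * vLong n + if σ = τ then (2 * eLong n : ℤ) else 2 * eShort n := by
  have h₁ : (n : ℤ) ^ 2 ≤ (n : ℤ) ^ 3 := by exact_mod_cast pow_three_ge_sq n
  have h₂ : (n : ℤ) ≤ (n : ℤ) ^ 2 := by exact_mod_cast le_sq n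
  unfold startBound endBound eShort vLong eLong
  rcases hσ with rfl | rfl <;> rcases hτ with rfl | rfl <;> rcases hc with rfl | rfl <;>
    norm_num <;> omega

/-- The link intervals of an edge whose ends are on the sides `σ` and `σ'`. -/
lemma edge_bound {σ σ' τ : ℤ} (hσ : σ = 1 ∨ σ = -1) (hσ' : σ' = 1 ∨ σ' = -1)
    (hτ : τ = 1 ∨ τ = -1) {c c' : Fin 2 → ℤ} (hc : ∀ a, c a = 1 ∨ c a = -1)
    (hc' : ∀ a, c' a = 1 ∨ c' a = -1) :
    ∑ a, (startBound n σ (c a) + endBound n τ Manner.second (c a)) +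
      ∑ a, (startBound n σ' (c' a) + endBound n τ Manner.third (c' a)) ≤
      8 * vLong n + 4 * eShort n + if σ ≠ σ' then (4 * eLong n : ℤ) else 0 := by
  have h₁ := start_end_second_le (n := n) hσ hτ (hc 0)
  have h₂ := start_end_second_le (n := n) hσ hτ (hc 1)
  have h₃ := start_end_third_le (n := n) hσ' hτ (hc' 0)
  have h₄ := start_end_third_le (n := n) hσ' hτ (hc' 1)
  rw [Fin.sum_univ_two, Fin.sum_univ_two]
  -- Decisive for σ = σ' = τ: all four intervals then gain 2q' at the E-gadget, and 8q' must not
  -- exceed 4p'.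
  have hp : 2 * eLong n ≤ eShort n := Nat.le_add_right _ _
  rcases hσ with rfl | rfl <;> rcases hτ with rfl | rfl <;> rcases hσ' with rfl | rfl <;>
    norm_num at * <;> omega

end Upper

/-! ### The two directions, in terms of signs -/

section Main

variable {V : Type*} {G : SimpleGraph V} {n m : ℕ} (v : Fin n ≃ V) (e : Fin m ≃ G.edgeSet)

/-- Four times the part of the threshold that does not depend on the size of the cut. -/
def baseValue (n m : ℕ) : ℤ :=
  n * (8 * vShort n * vLong n + 4 * (vLong n) ^ 2) +
    m * (8 * eShort n * eLong n + 4 * (eLong n) ^ 2) +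
    2 * (3 * n * (n - 1) * (2 * vShort n + 2 * vLong n) +
      2 * m * (m - 1) * (2 * eShort n + 2 * eLong n) + m * (8 * vLong n + 4 * eShort n))

lemma four_mul_threshold (h : 2 * m = 3 * n) (x : ℕ) :
    4 * threshold n x = ((baseValue n m + 8 * eLong n * x : ℤ) : ℚ) := by
  have hm : (m : ℚ) = 3 / 2 * n := by
    have : (2 * m : ℚ) = 3 * n := by exact_mod_cast h
    linarith
  unfold threshold baseValue
  push_cast
  rw [hm]
  ring

lemma sum_links (f : Fin m × Manner × Fin 2 → ℤ) :
    ∑ l, f l = ∑ j, (∑ a, f (j, Manner.second, a) + ∑ a, f (j, Manner.third, a)) := by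
  simp only [Fintype.sum_prod_type, sum_manner]

/-- By cubicity each vertex is the source of 3 · 2 link intervals, and four end at each edge. The
covered gadgets thus number 6∑(n - 1 - i) = 3n(n - 1) and 4∑j = 2m(m - 1), whatever the orderings.
-/
lemma sum_link_values [Fintype V] [DecidableRel G.Adj] (hG : G.IsRegularOfDegree 3) (C D : ℤ) (f g : Fin m × Manner × Fin 2 → ℤ) :
    ∑ l, (((n - 1 - (linkSource v e l.1 l.2.1 : ℕ)) * C + f l) + (l.1 * D + g l)) =
      3 * n * (n - 1) * C + 2 * m * (m - 1) * D + ∑ l, (f l + g l) := by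
  have h₁ : ∑ l : Fin m × Manner × Fin 2, ((n : ℤ) - 1 - (linkSource v e l.1 l.2.1 : ℕ)) =
      3 * n * (n - 1) := by
    rw [sum_links]
    simp only [Finset.sum_const, Finset.card_univ, Fintype.card_fin, nsmul_eq_mul, ← mul_add,
      ← Finset.mul_sum]
    rw [sum_linkSource v e hG (fun i => (n : ℤ) - 1 - (i : ℕ)), Finset.sum_sub_distrib]
    have := two_mul_sum_fin n
    simp only [Finset.sum_const, Finset.card_univ, Fintype.card_fin, nsmul_eq_mul]
    push_cast
    linarith
  have h₂ : ∑ l : Fin m × Manner × Fin 2, (l.1 : ℤ) = 2 * m * (m - 1) := by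
    rw [sum_links]
    simp only [Finset.sum_const, Finset.card_univ, Fintype.card_fin, nsmul_eq_mul, ← mul_add,
      ← Finset.mul_sum, Finset.sum_add_distrib]
    have := two_mul_sum_fin m
    push_cast
    linarith
  simp only [Finset.sum_add_distrib, ← Finset.sum_mul, h₁, h₂]
  ring

lemma linkLink_nonneg {s : Vertex n m → ℤ} (hs : ∀ a, s a = 1 ∨ s a = -1) :
    0 ≤ linkLink v e s :=
  Finset.sum_nonneg fun _ _ => Finset.sum_nonneg fun _ _ => crossing_nonneg _ _ (hs _) (hs _)

lemma card_links : Fintype.card (Fin m × Manner × Fin 2) = 4 * m := by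
  have : Fintype.card Manner = 2 := rfl
  simp only [Fintype.card_prod, Fintype.card_fin, this]
  ring

lemma linkLink_le {s : Vertex n m → ℤ} (hs : ∀ a, s a = 1 ∨ s a = -1) :
    linkLink v e s ≤ 16 * m ^ 2 := by
  calc linkLink v e s ≤ ∑ l : Fin m × Manner × Fin 2, ∑ l' : Fin m × Manner × Fin 2,
        (1 - s (Sum.inr (Sum.inr l)) * s (Sum.inr (Sum.inr l'))) :=
      Finset.sum_le_sum fun _ _ => Finset.sum_le_sum fun _ _ => crossing_le _ _ (hs _) (hs _)
    _ ≤ 16 * m ^ 2 := by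
      rw [sum_one_sub_mul, card_links]
      push_cast
      nlinarith [mul_self_nonneg (∑ l : Fin m × Manner × Fin 2, s (Sum.inr (Sum.inr l)))]

/-- From a cut of the reduction graph to a cut of the cubic graph. -/
lemma exists_sides_of_cut [Fintype V] [DecidableRel G.Adj] (hG : G.IsRegularOfDegree 3) (hn : n = 0 ∨ 4 ≤ n) {s : Vertex n m → ℤ}
    (hs : ∀ a, s a = 1 ∨ s a = -1) :
    ∃ σ : Fin n → ℤ, (∀ i, σ i = 1 ∨ σ i = -1) ∧
      ∑ a, ∑ b, crossing (ends v e a) (ends v e b) (s a) (s b) ≤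
        baseValue n m + 16 * m ^ 2 + 8 * eLong n *
          (Finset.univ.filter fun j => σ (linkSource v e j Manner.second) ≠
            σ (linkSource v e j Manner.third)).card := by
  have hmn := two_mul_card_edges hG v e
  have hmn' : (4 * m : ℤ) = 6 * n := by omega
  have hn2 : (n = 0 ∨ 4 * (n : ℤ) ≤ n ^ 2) := by
    rcases hn with h | h
    · exact Or.inl h
    · right; nlinarith
  -- With K = 4m = 6n, this yields both 5K ≤ q and, through `hbig`, 4K(p - q) ≤ 3q², for E- and
  -- V-gadgets alike. For n > 0 it rests on n ≥ 4.
  have hq : 37 * (n : ℤ) ≤ eLong n := by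
    unfold eLong
    push_cast
    rcases hn2 with rfl | h
    · simp
    · linarith
  have hqq : (eLong n : ℤ) ≤ vLong n := by
    have := pow_three_ge_sq n
    unfold eLong vLong
    omega
  have hbig : ∀ q : ℤ, 37 * (n : ℤ) ≤ q → 4 * (4 * m * (2 * q + 7 * n - q)) ≤ 3 * q ^ 2 := by
    intro q hq
    rw [hmn']
    nlinarith [mul_nonneg (Int.natCast_nonneg n) (sub_nonneg.2 hq),
      mul_nonneg (sub_nonneg.2 hq) (sub_nonneg.2 hq)]
  have hoddV : Odd (vLong n) := ⟨100 * n ^ 3, by unfold vLong; ring⟩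
  have hoddE : Odd (eLong n) := ⟨5 * n ^ 2, by unfold eLong; ring⟩
  have hV := fun i : Fin n => gadget_bound (K := 4 * m) (p := vShort n) (by positivity)
    (by omega) (Nat.le_add_right _ _)
    (by unfold vShort; push_cast; exact hbig _ (hq.trans hqq)) hoddV
    (fun g => s (Sum.inl (i, g))) fun g => hs _
  have hE := fun k : Fin m => gadget_bound (K := 4 * m) (p := eShort n) (by positivity)
    (by omega) (Nat.le_add_right _ _) (by unfold eShort; push_cast; exact hbig _ hq) hoddE
    (fun g => s (Sum.inr (Sum.inl (k, g)))) fun g => hs _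
  choose M _ σ _ hσ hM hM0 hMs using hV
  choose N τ _ hτ _ hN hN0 hNs using hE
  refine ⟨σ, hσ, ?_⟩
  have hLV : ∀ l, ∑ i, linkV v e s l i ≤
      (n - 1 - (linkSource v e l.1 l.2.1 : ℕ)) * (2 * vShort n + 2 * vLong n) +
        startBound n (σ (linkSource v e l.1 l.2.1)) (s (Sum.inr (Sum.inr l))) + ∑ i, M i := by
    intro l
    rw [← sum_of_lt_or_eq _ _ fun i => startBound n (σ i) (s (Sum.inr (Sum.inr l))),
      ← Finset.sum_add_distrib]
    refine Finset.sum_le_sum fun i _ => ?_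
    rw [linkV_eq]
    obtain ⟨h₁, h₂, -, -⟩ := hMs i _ (hs (Sum.inr (Sum.inr l)))
    have h₀ := hM0 i
    unfold startBound
    split_ifs at * <;> linarith
  have hLE : ∀ l, ∑ k, linkE v e s l k ≤
      l.1 * (2 * eShort n + 2 * eLong n) +
        endBound n (τ l.1) l.2.1 (s (Sum.inr (Sum.inr l))) + ∑ k, N k := by
    intro l
    rw [← sum_of_gt_or_eq _ _ fun k => endBound n (τ k) l.2.1 (s (Sum.inr (Sum.inr l))),
      ← Finset.sum_add_distrib]
    refine Finset.sum_le_sum fun k _ => ?_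
    rw [linkE_eq]
    obtain ⟨h₁, -, h₂, h₃⟩ := hNs k _ (hs (Sum.inr (Sum.inr l)))
    have h₀ := hN0 k
    obtain ⟨j, t, a⟩ := l
    simp only at *
    by_cases hk : k < j
    · rw [if_pos hk, if_pos hk]
      linarith
    · rw [if_neg hk, if_neg hk]
      by_cases hk' : k = j
      · rw [if_pos hk', if_pos hk']
        cases t
        · exact h₂
        · exact h₃
      · rw [if_neg hk', if_neg hk']
        linarith
  have hlinks : ∑ l, ((∑ i, linkV v e s l i) + ∑ k, linkE v e s l k) ≤
      3 * n * (n - 1) * (2 * vShort n + 2 * vLong n) +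
        2 * m * (m - 1) * (2 * eShort n + 2 * eLong n) +
        ∑ l : Fin m × Manner × Fin 2,
          (startBound n (σ (linkSource v e l.1 l.2.1)) (s (Sum.inr (Sum.inr l))) +
            endBound n (τ l.1) l.2.1 (s (Sum.inr (Sum.inr l)))) +
        4 * m * (∑ i, M i + ∑ k, N k) := by
    rw [← sum_link_values v e hG]
    have : (4 * m * (∑ i, M i + ∑ k, N k) : ℤ) =
        ∑ _l : Fin m × Manner × Fin 2, (∑ i, M i + ∑ k, N k) := by
      rw [Finset.sum_const, Finset.card_univ, card_links, nsmul_eq_mul]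
      push_cast
      ring
    rw [this, ← Finset.sum_add_distrib]
    refine Finset.sum_le_sum fun l _ => ?_
    linarith [hLV l, hLE l]
  have hedges : ∑ l : Fin m × Manner × Fin 2,
      (startBound n (σ (linkSource v e l.1 l.2.1)) (s (Sum.inr (Sum.inr l))) +
        endBound n (τ l.1) l.2.1 (s (Sum.inr (Sum.inr l)))) ≤
      m * (8 * vLong n + 4 * eShort n) + 4 * eLong n *
        (Finset.univ.filter fun j => σ (linkSource v e j Manner.second) ≠
            σ (linkSource v e j Manner.third)).card := by
    rw [sum_links]
    have hj := fun j => edge_bound (n := n) (hσ (linkSource v e j Manner.second))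
      (hσ (linkSource v e j Manner.third)) (hτ j)
      (fun a => hs (Sum.inr (Sum.inr (j, Manner.second, a))))
      (fun a => hs (Sum.inr (Sum.inr (j, Manner.third, a))))
    refine (Finset.sum_le_sum fun j _ => hj j).trans_eq ?_
    rw [Finset.sum_add_distrib, ← Finset.sum_filter, Finset.sum_const, Finset.sum_const,
      Finset.card_univ, Fintype.card_fin, nsmul_eq_mul, nsmul_eq_mul]
    ring
  have hlossV : ∑ i, (2 * (4 * m) * M i) ≤ ∑ i, gadgetLoss fun g => s (Sum.inl (i, g)) :=
    Finset.sum_le_sum fun i _ => hM i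
  have hlossE : ∑ k, (2 * (4 * m) * N k) ≤ ∑ k, gadgetLoss fun g => s (Sum.inr (Sum.inl (k, g))) :=
    Finset.sum_le_sum fun k _ => hN k
  rw [← Finset.mul_sum] at hlossV hlossE
  have hLL := linkLink_le v e hs
  rw [sum_crossing_eq v e s hs, Finset.sum_sub_distrib, Finset.sum_sub_distrib]
  simp only [Finset.sum_const, Finset.card_univ, Fintype.card_fin, nsmul_eq_mul]
  unfold baseValue
  -- The excess 2 · 4m · (∑M + ∑N) of the link intervals cancels against the losses.
  linear_combination 2 * hlinks + 2 * hedges + hlossV + hlossE + hLL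

/-- The sides of the intervals of a gadget in an optimal cut of it, with the left long intervals
on the side `τ`. -/
def gadgetSides {q p : ℕ} (τ : ℤ) : Gadget q p → ℤ
  | Sum.inl (Sum.inl _) => τ
  | Sum.inl (Sum.inr _) => -τ
  | Sum.inr (Sum.inl _) => -τ
  | Sum.inr (Sum.inr _) => τ

/-- The sides of the intervals of the construction, for given sides `σ` of the vertices. -/
def sides (σ : Fin n → ℤ) : Vertex n m → ℤ
  | Sum.inl (i, g) => gadgetSides (-σ i) g
  | Sum.inr (Sum.inl (j, g)) => gadgetSides (-σ (linkSource v e j Manner.third)) g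
  | Sum.inr (Sum.inr (j, t, _)) => -σ (linkSource v e j t)

lemma sides_eq (σ : Fin n → ℤ) (hσ : ∀ i, σ i = 1 ∨ σ i = -1) (a : Vertex n m) :
    sides v e σ a = 1 ∨ sides v e σ a = -1 := by
  rcases a with ⟨i, (g | g) | (g | g)⟩ | ⟨j, (g | g) | (g | g)⟩ | ⟨j, t, c⟩ <;>
    simp only [sides, gadgetSides]
  · rcases hσ i with h | h <;> simp [h]
  · rcases hσ i with h | h <;> simp [h]
  · rcases hσ i with h | h <;> simp [h]
  · rcases hσ i with h | h <;> simp [h]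
  · rcases hσ (linkSource v e j Manner.third) with h | h <;> simp [h]
  · rcases hσ (linkSource v e j Manner.third) with h | h <;> simp [h]
  · rcases hσ (linkSource v e j Manner.third) with h | h <;> simp [h]
  · rcases hσ (linkSource v e j Manner.third) with h | h <;> simp [h]
  · rcases hσ (linkSource v e j t) with h | h <;> simp [h]

/-- From a cut of the cubic graph to a cut of the reduction graph. -/
lemma le_sum_crossing_sides [Fintype V] [DecidableRel G.Adj] (hG : G.IsRegularOfDegree 3) (σ : Fin n → ℤ)
    (hσ : ∀ i, σ i = 1 ∨ σ i = -1) :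
    baseValue n m + 8 * eLong n *
        (Finset.univ.filter fun j => σ (linkSource v e j Manner.second) ≠
          σ (linkSource v e j Manner.third)).card ≤
      ∑ a, ∑ b, crossing (ends v e a) (ends v e b) (sides v e σ a) (sides v e σ b) := by
  have hs := sides_eq v e σ hσ
  have hsq : ∀ i, σ i * σ i = 1 := fun i => by rcases hσ i with h | h <;> simp [h]
  have hx : ∀ {q p : ℕ} (τ : ℤ), leftLongSum (gadgetSides (q := q) (p := p) τ) = q * τ := by
    intro q p τ; simp [leftLongSum, gadgetSides]
  have hy : ∀ {q p : ℕ} (τ : ℤ), leftShortSum (gadgetSides (q := q) (p := p) τ) = -(p * τ) := by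
    intro q p τ; simp [leftShortSum, gadgetSides]
  have hz : ∀ {q p : ℕ} (τ : ℤ), rightLongSum (gadgetSides (q := q) (p := p) τ) = -(q * τ) := by
    intro q p τ; simp [rightLongSum, gadgetSides]
  have ht : ∀ {q p : ℕ} (τ : ℤ), rightShortSum (gadgetSides (q := q) (p := p) τ) = p * τ := by
    intro q p τ; simp [rightShortSum, gadgetSides]
  have hsum : ∀ {q p : ℕ} (τ : ℤ), gadgetSum (gadgetSides (q := q) (p := p) τ) = 0 := by
    intro q p τ; simp [gadgetSum, hx, hy, hz, ht]
  have hloss : ∀ {q p : ℕ} (i : Fin n),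
      gadgetLoss (gadgetSides (q := q) (p := p) (-σ i)) = 0 := by
    intro q p i
    rcases hσ i with h | h <;> rw [h] <;> simp only [gadgetLoss, hx, hy, hz, ht] <;> ring
  have hgV : ∀ i, (fun g => sides v e σ (Sum.inl (i, g))) = gadgetSides (-σ i) := fun i => rfl
  have hgE : ∀ k, (fun g => sides v e σ (Sum.inr (Sum.inl (k, g)))) =
      gadgetSides (-σ (linkSource v e k Manner.third)) := fun k => rfl
  -- Each link interval is opposite to all right long intervals at its source, and covered gadgets
  -- have sign sum 0.
  have hLV : ∀ l, ∑ i, linkV v e (sides v e σ) l i =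
      (n - 1 - (linkSource v e l.1 l.2.1 : ℕ)) * (2 * vShort n + 2 * vLong n) + 2 * vLong n := by
    intro l
    rw [← sum_of_lt_or_eq _ _ fun _ => 2 * (vLong n : ℤ)]
    refine Finset.sum_congr rfl fun i _ => ?_
    rw [linkV_eq, hgV, hsum, hz]
    refine if_congr Iff.rfl (by ring) (if_ctx_congr Iff.rfl (fun h => ?_) fun _ => rfl)
    rw [← h]
    have := hsq (linkSource v e l.1 l.2.1)
    simp only [sides]
    linear_combination (vLong n : ℤ) * this
  -- At its end, a third-manner interval is opposite to all left short and no left long intervals; a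
  -- second-manner one is opposite to the left long intervals exactly when its edge is cut.
  have hLE : ∀ l, ∑ k, linkE v e (sides v e σ) l k =
      l.1 * (2 * eShort n + 2 * eLong n) + (match l.2.1 with
        | Manner.second => eLong n - eLong n * (σ (linkSource v e l.1 Manner.second) *
            σ (linkSource v e l.1 Manner.third))
        | Manner.third => 2 * (eShort n : ℤ)) := by
    intro l
    rw [← sum_of_gt_or_eq _ _ fun k => (match l.2.1 with
        | Manner.second => eLong n - eLong n * (σ (linkSource v e k Manner.second) *
            σ (linkSource v e k Manner.third))
        | Manner.third => 2 * (eShort n : ℤ))]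
    refine Finset.sum_congr rfl fun k _ => ?_
    rw [linkE_eq, hgE, hsum, hx, hy]
    refine if_congr Iff.rfl (by ring) (if_ctx_congr Iff.rfl (fun h => ?_) fun _ => rfl)
    obtain ⟨j, t, a⟩ := l
    obtain rfl : k = j := h
    cases t
    · simp only [sides]
      ring
    · have := hsq (linkSource v e k Manner.third)
      simp only [sides]
      linear_combination ((eShort n : ℤ) - eLong n) * this
  have hcut : ∀ i k, (eLong n : ℤ) - eLong n * (σ i * σ k) = if σ i ≠ σ k then
      (2 * eLong n : ℤ) else 0 := by
    intro i k
    rcases hσ i with h | h <;> rcases hσ k with h' | h' <;> rw [h, h'] <;> norm_num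
    all_goals ring
  have hLL := linkLink_nonneg v e hs
  rw [sum_crossing_eq v e _ hs]
  simp only [hgV, hgE, hloss, hLV, hLE, sub_zero]
  rw [sum_link_values v e hG, sum_links]
  simp only [hcut, Finset.sum_const, Finset.card_univ, Fintype.card_fin, nsmul_eq_mul,
    Finset.sum_add_distrib, mul_add, mul_ite, mul_zero]
  rw [← Finset.sum_filter]
  simp only [Finset.sum_const, nsmul_eq_mul]
  unfold baseValue
  push_cast
  linarith

end Main

/-! ### From the reduction graph to sums of signs -/

section

variable {V : Type*} {G : SimpleGraph V} {n m : ℕ} (v : Fin n ≃ V) (e : Fin m ≃ G.edgeSet)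

lemma ends_fst_le_snd (a : Vertex n m) : (ends v e a).1 ≤ (ends v e a).2 := by
  rcases a with ⟨i, g⟩ | ⟨j, g⟩ | ⟨j, t, c⟩
  · exact (Gadget.ends_bounds _ g).2.1
  · exact (Gadget.ends_bounds _ g).2.1
  · have h₁ := linkLeft_le (linkSource v e j t) c
    have h₂ := linkRight_bounds (n := n) j t
    have h₃ := vOffset_add_le_eOffset (linkSource v e j t) j
    simp only [ends]
    omega

lemma reductionGraph_adj (a b : Vertex n m) : (reductionGraph v e).Adj a b ↔
    a ≠ b ∧ (ends v e a).1 ≤ (ends v e b).2 ∧ (ends v e b).1 ≤ (ends v e a).2 := by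
  have ha := ends_fst_le_snd v e a
  have hb := ends_fst_le_snd v e b
  change a ≠ b ∧ (interval v e a ∩ interval v e b).Nonempty ↔ _
  unfold interval
  rw [Set.Icc_inter_Icc, Set.nonempty_Icc, max_le_iff, le_min_iff, le_min_iff]
  simp only [Nat.cast_le]
  tauto

lemma four_mul_ncard_reductionGraph_cut {A B : Set (Vertex n m)} (hAB : A ∪ B = Set.univ)
    (hAB' : A ∩ B = ∅) {s : Vertex n m → ℤ} (hs : ∀ a, s a = 1 ∨ s a = -1)
    (hA : ∀ a ∈ A, s a = 1) (hB : ∀ b ∈ B, s b = -1) :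
    4 * (Set.ncard {z ∈ (reductionGraph v e).edgeSet | ∃ a ∈ A, ∃ b ∈ B, z = s(a, b)} : ℤ) =
      ∑ a, ∑ b, crossing (ends v e a) (ends v e b) (s a) (s b) := by
  refine four_mul_ncard_cut _ A B hAB hAB' s hA hB _ (fun a b h => ?_) fun a b h => ?_
  · exact crossing_of_meet ((reductionGraph_adj v e a b).1 h).2 _ _
  · rw [reductionGraph_adj] at h
    by_cases hab : a = b
    · subst hab
      unfold crossing
      rcases hs a with h' | h' <;> simp [h']
    · exact crossing_of_not_meet (fun h' => h ⟨hab, h'⟩) _ _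

/-- A vertex and its three neighbours are four distinct vertices. -/
lemma eq_zero_or_four_le [Fintype V] [DecidableRel G.Adj] (hG : G.IsRegularOfDegree 3)
    (v : Fin n ≃ V) : n = 0 ∨ 4 ≤ n := by
  rcases Nat.eq_zero_or_pos n with h | h
  · exact Or.inl h
  · right
    have := G.degree_lt_card_verts (v ⟨0, h⟩)
    rw [hG.degree_eq, ← Fintype.card_congr v, Fintype.card_fin] at this
    omega

end

end MaxCutReduction

/-! ### The equivalence -/

open MaxCutReduction in
theorem lemma6 {V : Type*} [Fintype V] (G : SimpleGraph V) [DecidableRel G.Adj]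
    (hG : G.IsRegularOfDegree 3) {n m : ℕ} (v : Fin n ≃ V) (e : Fin m ≃ G.edgeSet) (x : ℕ) :
    G.HasCutOfSizeAtLeast x ↔
      (MaxCutReduction.reductionGraph v e).HasCutOfSizeAtLeast
        (MaxCutReduction.threshold n x) := by
  classical
  have hmn := two_mul_card_edges hG v e
  constructor
  · rintro ⟨A, B, hAB, hAB', hx⟩
    have hdisj : ∀ b ∈ B, b ∉ A := fun b hb ha => by
      have : b ∈ A ∩ B := ⟨ha, hb⟩
      simp [hAB'] at this
    have hσ : ∀ i, (if v i ∈ A then (1 : ℤ) else -1) = 1 ∨ (if v i ∈ A then (1 : ℤ) else -1) = -1 :=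
      fun i => by split_ifs <;> simp
    rw [ncard_cut_eq v e hAB (σ := fun i => if v i ∈ A then 1 else -1) (fun i h => if_pos h)
      (fun i h => if_neg (hdisj _ h))] at hx
    have hle := le_sum_crossing_sides v e hG _ hσ
    have hs := sides_eq v e _ hσ
    generalize sides v e (fun i => if v i ∈ A then (1 : ℤ) else -1) = s at hle hs
    refine ⟨{a | s a = 1}, {a | s a = -1}, ?_, ?_, ?_⟩
    · ext a
      simpa using hs a
    · ext a
      simp only [Set.mem_inter_iff, Set.mem_ofPred_eq, Set.mem_empty_iff_false, iff_false, not_and]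
      intro h h'
      omega
    · rw [← four_mul_ncard_reductionGraph_cut v e (A := {a | s a = 1}) (B := {a | s a = -1})
        (by ext a; simpa using hs a)
        (by
          ext a
          simp only [Set.mem_inter_iff, Set.mem_ofPred_eq, Set.mem_empty_iff_false, iff_false,
            not_and]
          omega) hs (fun a h => h) (fun a h => h)] at hle
      have h4 := four_mul_threshold hmn x
      have hx' := Nat.cast_le.1 hx
      have hmul : (eLong n : ℤ) * x ≤ eLong n * _ :=
        mul_le_mul_of_nonneg_left (Nat.cast_le.2 hx') (by positivity)
      have := (Int.cast_le (R := ℚ)).2 ((show _ ≤ _ by linarith :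
        baseValue n m + 8 * eLong n * x ≤ _).trans hle)
      rw [← h4] at this
      push_cast at this
      linarith
  · rintro ⟨A, B, hAB, hAB', hx⟩
    have hdisj : ∀ b ∈ B, b ∉ A := fun b hb ha => by
      have : b ∈ A ∩ B := ⟨ha, hb⟩
      simp [hAB'] at this
    have hs : ∀ a, (if a ∈ A then (1 : ℤ) else -1) = 1 ∨ (if a ∈ A then (1 : ℤ) else -1) = -1 :=
      fun a => by split_ifs <;> simp
    obtain ⟨σ, hσ, hle⟩ := exists_sides_of_cut v e hG (eq_zero_or_four_le hG v) hs
    rw [← four_mul_ncard_reductionGraph_cut v e hAB hAB' hs (fun a h => if_pos h)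
      (fun a h => if_neg (hdisj _ h))] at hle
    have hcov : {u | σ (v.symm u) = 1} ∪ {u | σ (v.symm u) = -1} = Set.univ := by
      ext u
      simpa using hσ (v.symm u)
    refine ⟨{u | σ (v.symm u) = 1}, {u | σ (v.symm u) = -1}, hcov, ?_, ?_⟩
    · ext u
      simp only [Set.mem_inter_iff, Set.mem_ofPred_eq, Set.mem_empty_iff_false, iff_false, not_and]
      omega
    · rw [ncard_cut_eq v e hcov (σ := σ) (fun i h => by simpa using h) (fun i h => by simpa using h),
        Nat.cast_le]
      have h4 := four_mul_threshold hmn x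
      have hx4 : ((baseValue n m + 8 * eLong n * x : ℤ) : ℚ) ≤ ((4 * (Set.ncard
          {z ∈ (reductionGraph v e).edgeSet | ∃ a ∈ A, ∃ b ∈ B, z = s(a, b)} : ℤ) : ℤ) : ℚ) := by
        rw [← h4]
        push_cast
        linarith
      have hle' := (Int.cast_le.1 hx4).trans hle
      generalize (Finset.univ.filter fun j => σ (linkSource v e j Manner.second) ≠
        σ (linkSource v e j Manner.third)).card = y at *
      by_contra hlt
      have hyx : (y : ℤ) + 1 ≤ x := by omega
      have hmul : (eLong n : ℤ) * (y + 1) ≤ eLong n * x :=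
        mul_le_mul_of_nonneg_left hyx (by positivity)
      -- If y < x, then 8q' ≤ 16m² = 36n², contradicting 8q' = 80n² + 8.
      have hm2 : (4 * m ^ 2 : ℤ) = 9 * n ^ 2 := by
        have : (2 * m : ℤ) = 3 * n := by exact_mod_cast hmn
        linear_combination (2 * (m : ℤ) + 3 * n) * this
      have hel : (eLong n : ℤ) = 10 * n ^ 2 + 1 := by unfold eLong; push_cast; rfl
      nlinarith [sq_nonneg (n : ℤ)]
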